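/- Let $V$ be a closed connected smooth manifold and let $\xi=\ker\alpha$ be a contact structure on $V$ cooriented by a contact form $\alpha$. Let $\widetilde{\mathrm{Cont}}_0(V,\xi)$ be the universal cover of the identity component of the group of contactomorphisms of $(V,\xi)$, that is the group of smooth contact isotopies $\{\phi_t\}_{t\in[0,1]}$ with $\phi_0=\mathrm{id}$ modulo homotopy with fixed end points. The contact Hamiltonian of such an isotopy is the smooth function $h:[0,1]\times V\to\mathbb{R}$ with $h_t(\phi_t(x))=\alpha\big(\tfrac{d}{dt}\phi_t(x)\big)$; this gives a bijection between smooth functions $h$ on $[0,1]\times V$ and contact isotopies starting at $\mathrm{id}$, and $\widetilde\phi_h$ denotes the element represented by the isotopy with contact Hamiltonian $h$. Write $\mathrm{id}\preceq\widetilde\phi$ if $\widetilde\phi=\widetilde\phi_h$ for some $h\ge 0$, and $\widetilde\phi\preceq\widetilde\psi$ if $\mathrm{id}\preceq\widetilde\phi^{-1}\widetilde\psi$. A monotone quasi-morphism is a non-zero function $\mu:\widetilde{\mathrm{Cont}}_0(V,\xi)\to\mathbb{R}$ such that $|\mu(ab)-\mu(a)-\mu(b)|\le D$ for some constant $D>0$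 and all $a,b$, such that $\mu(a^k)=k\mu(a)$ for all $a$ and all $k\in\mathbb{Z}$, and such that $\widetilde\phi\preceq\widetilde\psi$ implies $\mu(\widetilde\phi)\le\mu(\widetilde\psi)$. A closed subset $Y\subset V$ is called $\mu$-subheavy if $\mu(\widetilde\phi_h)=0$ for every autonomous $h\in C^\infty(V)$ with $h|_Y=0$, and $\mu$-superheavy if $\mu(\widetilde\phi_h)>0$ for every autonomous $h\in C^\infty(V)$ with $h|_Y>0$. Proposition. Let $\mu:\widetilde{\mathrm{Cont}}_0(V,\xi)\to\mathbb{R}$ be a monotone quasi-morphism and let $Y\subset V$ be a $\mu$-subheavy (in particular closed) subset. If $Y$ is preserved by the flow $\theta_t$ of some contact vector field $X$ that is positive, i.e. $\alpha(X)>0$ everywhere (so $\theta_t(Y)=Y$ for all $t\in\mathbb{R}$), then $Y$ is $\mu$-superheavy. -/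

import Mathlib

open Set
open scoped Manifold ContDiff

noncomputable section

namespace ContactQM

section Definitions

variable {E : Type*} [NormedAddCommGroup E] [NormedSpace ℝ E]
  {V : Type*} [TopologicalSpace V] [ChartedSpace E V]

/-! ### One-forms, exterior derivative, contact forms -/

/-- The pull-back of a one-form `α` on `V` to the model space `E` under the inverse of the preferred
chart around `x` (meaningful on the target of that chart, which is open). -/
def localForm (α : ∀ x : V, TangentSpace 𝓘(ℝ, E) x →L[ℝ] ℝ) (x : V) (y : E) : E →L[ℝ] ℝ :=
  (α ((extChartAt 𝓘(ℝ, E) x).symm y)).comp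
    (mfderiv 𝓘(ℝ, E) 𝓘(ℝ, E) (extChartAt 𝓘(ℝ, E) x).symm y)

/-- The exterior derivative `dα` of a one-form at `x`, computed in the preferred chart around `x`.
(In Mathlib the tangent space at `x` is identified with `E` through this very chart.) -/
def extD (α : ∀ x : V, TangentSpace 𝓘(ℝ, E) x →L[ℝ] ℝ) (x : V)
    (v w : TangentSpace 𝓘(ℝ, E) x) : ℝ :=
  fderiv ℝ (localForm α x) (extChartAt 𝓘(ℝ, E) x x) v w
    - fderiv ℝ (localForm α x) (extChartAt 𝓘(ℝ, E) x x) w v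

variable (E V) in
/-- A (coorienting) contact form on `V`: a smooth, nowhere vanishing one-form `α` such that `dα` is
nondegenerate on every hyperplane `ker α_x`. -/
structure ContactForm [IsManifold 𝓘(ℝ, E) ∞ V] where
  /-- the underlying one-form -/
  form : ∀ x : V, TangentSpace 𝓘(ℝ, E) x →L[ℝ] ℝ
  contMDiff : ContMDiff 𝓘(ℝ, E) (𝓘(ℝ, E).prod 𝓘(ℝ, E →L[ℝ] ℝ)) ∞
    (fun x : V => Bundle.TotalSpace.mk' (E →L[ℝ] ℝ)
      (E := fun x : V => TangentSpace 𝓘(ℝ, E) x →L[ℝ] Bundle.Trivial V ℝ x) x (form x))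
  ne_zero : ∀ x, form x ≠ 0
  nondegenerate : ∀ x v, form x v = 0 → (∀ w, form x w = 0 → extD form x v w = 0) → v = 0

/-- The contact structure `ξ = ker α`, cooriented by `α`. -/
def ContactForm.contactStructure [IsManifold 𝓘(ℝ, E) ∞ V] (α : ContactForm E V) (x : V) :
    Submodule ℝ (TangentSpace 𝓘(ℝ, E) x) :=
  LinearMap.ker (α.form x).toLinearMap

/-! ### The universal cover of the identity component of the contactomorphism group -/

/-- A family of bijections `F m : V → V`, smooth in `(m, x)` for `m ∈ S`, and likewise for the
family of the inverses. (So each `F m` with `m ∈ S` is a diffeomorphism.) -/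
def IsSmoothFamily {M : Type*} [NormedAddCommGroup M] [NormedSpace ℝ M]
    (S : Set M) (F : M → Equiv.Perm V) : Prop :=
  ContMDiffOn (𝓘(ℝ, M).prod 𝓘(ℝ, E)) 𝓘(ℝ, E) ∞ (fun p : M × V => F p.1 p.2) (S ×ˢ univ) ∧
  ContMDiffOn (𝓘(ℝ, M).prod 𝓘(ℝ, E)) 𝓘(ℝ, E) ∞ (fun p : M × V => (F p.1)⁻¹ p.2) (S ×ˢ univ)

/-- `f` maps the hyperplane field `ξ` to itself. -/
def Preserves (ξ : ∀ x : V, Submodule ℝ (TangentSpace 𝓘(ℝ, E) x)) (f : V → V) : Prop :=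
  ∀ (x : V) (v : TangentSpace 𝓘(ℝ, E) x),
    mfderiv 𝓘(ℝ, E) 𝓘(ℝ, E) f x v ∈ ξ (f x) ↔ v ∈ ξ x

/-- A smooth contact isotopy `{φ_t}`, `t ∈ [0,1]`, of `(V, ξ)` with `φ_0 = id`. Only the
times `t ∈ [0,1]` matter: the values at other times carry no information. -/
@[ext] structure ContactIsotopy (ξ : ∀ x : V, Submodule ℝ (TangentSpace 𝓘(ℝ, E) x)) where
  /-- the diffeomorphism at time `t` -/
  at_ : ℝ → Equiv.Perm V
  smooth : IsSmoothFamily (E := E) (Icc (0 : ℝ) 1) at_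
  zero : at_ 0 = 1
  contact : ∀ t ∈ Icc (0 : ℝ) 1, Preserves ξ (at_ t)

section Families

variable {M : Type*} [NormedAddCommGroup M] [NormedSpace ℝ M] {S : Set M}
  {F G : M → Equiv.Perm V}

theorem IsSmoothFamily.one : IsSmoothFamily (E := E) S (fun _ : M => (1 : Equiv.Perm V)) :=
  ⟨contMDiffOn_snd, contMDiffOn_snd⟩

theorem IsSmoothFamily.inv (hF : IsSmoothFamily (E := E) S F) :
    IsSmoothFamily (E := E) S (fun m => (F m)⁻¹) :=
  ⟨hF.2, by simpa using hF.1⟩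

theorem IsSmoothFamily.mul (hF : IsSmoothFamily (E := E) S F) (hG : IsSmoothFamily (E := E) S G) :
    IsSmoothFamily (E := E) S (fun m => F m * G m) := by
  refine ⟨?_, ?_⟩
  · exact hF.1.comp (contMDiffOn_fst.prodMk hG.1) (fun p hp => ⟨hp.1, mem_univ _⟩)
  · simp only [mul_inv_rev]
    exact hG.2.comp (contMDiffOn_fst.prodMk hF.2) (fun p hp => ⟨hp.1, mem_univ _⟩)

theorem IsSmoothFamily.comp {M' : Type*} [NormedAddCommGroup M'] [NormedSpace ℝ M'] {S' : Set M'}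
    (hF : IsSmoothFamily (E := E) S F) (c : M' → M) (hc : ContDiff ℝ ∞ c) (hS : MapsTo c S' S) :
    IsSmoothFamily (E := E) S' (fun m => F (c m)) := by
  have h : ContMDiffOn (𝓘(ℝ, M').prod 𝓘(ℝ, E)) (𝓘(ℝ, M).prod 𝓘(ℝ, E)) ∞
      (fun p : M' × V => (c p.1, p.2)) (S' ×ˢ univ) :=
    ((hc.contMDiff.comp contMDiff_fst).prodMk contMDiff_snd).contMDiffOn
  exact ⟨hF.1.comp h (fun p hp => ⟨hS hp.1, mem_univ _⟩),
    hF.2.comp h (fun p hp => ⟨hS hp.1, mem_univ _⟩)⟩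

theorem IsSmoothFamily.contMDiff (hF : IsSmoothFamily (E := E) S F) {m : M} (hm : m ∈ S) :
    ContMDiff 𝓘(ℝ, E) 𝓘(ℝ, E) ∞ (F m) := by
  have h : ContMDiff 𝓘(ℝ, E) (𝓘(ℝ, M).prod 𝓘(ℝ, E)) ∞ (fun x : V => (m, x)) :=
    contMDiff_const.prodMk contMDiff_id
  exact contMDiffOn_univ.1 (hF.1.comp h.contMDiffOn (fun x _ => ⟨hm, mem_univ _⟩))

end Families

variable {ξ : ∀ x : V, Submodule ℝ (TangentSpace 𝓘(ℝ, E) x)}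

theorem Preserves.one : Preserves ξ (1 : Equiv.Perm V) := by
  intro x v
  have h : ((1 : Equiv.Perm V) : V → V) = id := rfl
  rw [h, mfderiv_id]
  rfl

theorem Preserves.mul {f g : Equiv.Perm V} (hf : Preserves ξ f) (hg : Preserves ξ g)
    (hf' : MDifferentiable 𝓘(ℝ, E) 𝓘(ℝ, E) f) (hg' : MDifferentiable 𝓘(ℝ, E) 𝓘(ℝ, E) g) :
    Preserves ξ (f * g : Equiv.Perm V) := by
  intro x v
  have h : ((f * g : Equiv.Perm V) : V → V) = f ∘ g := rfl
  rw [h, mfderiv_comp x (hf' (g x)) (hg' x)]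
  exact (hf (g x) _).trans (hg x v)

theorem Preserves.inv {f : Equiv.Perm V} (hf : Preserves ξ f)
    (hf' : MDifferentiable 𝓘(ℝ, E) 𝓘(ℝ, E) f)
    (hg' : MDifferentiable 𝓘(ℝ, E) 𝓘(ℝ, E) (f⁻¹ : Equiv.Perm V)) :
    Preserves ξ (f⁻¹ : Equiv.Perm V) := by
  intro x v
  have h1 := hf ((f⁻¹ : Equiv.Perm V) x)
    (mfderiv 𝓘(ℝ, E) 𝓘(ℝ, E) (f⁻¹ : Equiv.Perm V) x v)
  rw [← h1]
  have h3 : (f : V → V) ∘ (f⁻¹ : Equiv.Perm V) = id := by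
    funext y; exact f.apply_symm_apply y
  have h2 := mfderiv_comp x (hf' ((f⁻¹ : Equiv.Perm V) x)) (hg' x)
  rw [h3, mfderiv_id] at h2
  have h4 : mfderiv 𝓘(ℝ, E) 𝓘(ℝ, E) f ((f⁻¹ : Equiv.Perm V) x)
      (mfderiv 𝓘(ℝ, E) 𝓘(ℝ, E) (f⁻¹ : Equiv.Perm V) x v) = v :=
    (congrArg (fun L => L v) h2).symm
  have h5 : ∀ y, y = x → (v ∈ (ξ y : Submodule ℝ E) ↔ v ∈ (ξ x : Submodule ℝ E)) := by
    rintro y rfl; rfl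
  exact (iff_of_eq (congrArg (fun u : E => u ∈ (ξ (f ((f⁻¹ : Equiv.Perm V) x)) : Submodule ℝ E))
    h4)).trans (h5 _ (f.apply_symm_apply x))

/-- The group structure on contact isotopies is composition at each time. -/
instance : One (ContactIsotopy ξ) where
  one := ⟨fun _ => 1, IsSmoothFamily.one, rfl, fun _ _ => Preserves.one⟩

instance : Mul (ContactIsotopy ξ) where
  mul φ ψ := ⟨fun t => φ.at_ t * ψ.at_ t, φ.smooth.mul ψ.smooth, by simp [φ.zero, ψ.zero],
    fun t ht => (φ.contact t ht).mul (ψ.contact t ht)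
      ((φ.smooth.contMDiff ht).mdifferentiable (by simp))
      ((ψ.smooth.contMDiff ht).mdifferentiable (by simp))⟩

instance : Inv (ContactIsotopy ξ) where
  inv φ := ⟨fun t => (φ.at_ t)⁻¹, φ.smooth.inv, by simp [φ.zero],
    fun t ht => (φ.contact t ht).inv
      ((φ.smooth.contMDiff ht).mdifferentiable (by simp))
      ((φ.smooth.inv.contMDiff ht).mdifferentiable (by simp))⟩

theorem ContactIsotopy.one_at (t : ℝ) : (1 : ContactIsotopy ξ).at_ t = 1 := rfl

theorem ContactIsotopy.mul_at (φ ψ : ContactIsotopy ξ) (t : ℝ) :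
    (φ * ψ).at_ t = φ.at_ t * ψ.at_ t := rfl

theorem ContactIsotopy.inv_at (φ : ContactIsotopy ξ) (t : ℝ) :
    (φ⁻¹).at_ t = (φ.at_ t)⁻¹ := rfl

instance : Group (ContactIsotopy ξ) :=
  Group.ofLeftAxioms
    (fun a b c => ContactIsotopy.ext (funext fun t => mul_assoc (a.at_ t) (b.at_ t) (c.at_ t)))
    (fun a => ContactIsotopy.ext (funext fun t => one_mul (a.at_ t)))
    (fun a => ContactIsotopy.ext (funext fun t => inv_mul_cancel (a.at_ t)))

/-- Two contact isotopies are homotopic if they have the same end point and can be joined by a smooth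
family `K s`, `s ∈ [0,1]`, of contact isotopies from `id` to that end point. -/
def Homotopic (φ ψ : ContactIsotopy ξ) : Prop :=
  ∃ K : ℝ → ContactIsotopy ξ,
    IsSmoothFamily (E := E) (Icc (0 : ℝ) 1 ×ˢ Icc (0 : ℝ) 1)
      (fun p : ℝ × ℝ => (K p.1).at_ p.2) ∧
    (∀ t ∈ Icc (0 : ℝ) 1, (K 0).at_ t = φ.at_ t) ∧
    (∀ t ∈ Icc (0 : ℝ) 1, (K 1).at_ t = ψ.at_ t) ∧
    (∀ s ∈ Icc (0 : ℝ) 1, (K s).at_ 1 = φ.at_ 1)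

theorem smoothFamily_const (φ : ContactIsotopy ξ) :
    IsSmoothFamily (E := E) (Icc (0 : ℝ) 1 ×ˢ Icc (0 : ℝ) 1) (fun p : ℝ × ℝ => φ.at_ p.2) :=
  φ.smooth.comp Prod.snd contDiff_snd (fun _ hp => hp.2)

theorem Homotopic.refl (φ : ContactIsotopy ξ) : Homotopic φ φ :=
  ⟨fun _ => φ, smoothFamily_const φ, fun _ _ => rfl, fun _ _ => rfl, fun _ _ => rfl⟩

theorem Homotopic.end_eq {φ ψ : ContactIsotopy ξ} (h : Homotopic φ ψ) : φ.at_ 1 = ψ.at_ 1 := by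
  obtain ⟨K, -, -, h1, h2⟩ := h
  rw [← h1 1 (by simp), h2 1 (by simp)]

theorem Homotopic.symm {φ ψ : ContactIsotopy ξ} (h : Homotopic φ ψ) : Homotopic ψ φ := by
  have he := h.end_eq
  obtain ⟨K, hK, h0, h1, h2⟩ := h
  refine ⟨fun s => K (1 - s), ?_, fun t ht => ?_, fun t ht => ?_, fun s hs => ?_⟩
  · refine hK.comp (fun p : ℝ × ℝ => (1 - p.1, p.2)) (by fun_prop) (fun p hp => ?_)
    obtain ⟨⟨ha, hb⟩, hc⟩ := hp
    exact ⟨⟨by simpa using hb, by simpa using ha⟩, hc⟩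
  · simpa using h1 t ht
  · simpa using h0 t ht
  · rw [← he]
    exact h2 _ ⟨by linarith [hs.2], by linarith [hs.1]⟩

theorem Homotopic.trans {φ ψ χ : ContactIsotopy ξ} (h : Homotopic φ ψ) (h' : Homotopic ψ χ) :
    Homotopic φ χ := by
  have he := h.end_eq
  obtain ⟨K, hK, h0, h1, h2⟩ := h
  obtain ⟨L, hL, h0', h1', h2'⟩ := h'
  refine ⟨fun s => K s * ψ⁻¹ * L s, (hK.mul (smoothFamily_const ψ).inv).mul hL,
    fun t ht => ?_, fun t ht => ?_, fun s hs => ?_⟩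
  · simp [ContactIsotopy.mul_at, ContactIsotopy.inv_at, h0 t ht, h0' t ht]
  · simp [ContactIsotopy.mul_at, ContactIsotopy.inv_at, h1 t ht, h1' t ht]
  · simp [ContactIsotopy.mul_at, ContactIsotopy.inv_at, h2 s hs, h2' s hs]

theorem Homotopic.mul {φ ψ φ' ψ' : ContactIsotopy ξ} (h : Homotopic φ ψ)
    (h' : Homotopic φ' ψ') : Homotopic (φ * φ') (ψ * ψ') := by
  obtain ⟨K, hK, h0, h1, h2⟩ := h
  obtain ⟨L, hL, h0', h1', h2'⟩ := h'
  refine ⟨fun s => K s * L s, hK.mul hL, fun t ht => ?_, fun t ht => ?_, fun s hs => ?_⟩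
  · simp [ContactIsotopy.mul_at, h0 t ht, h0' t ht]
  · simp [ContactIsotopy.mul_at, h1 t ht, h1' t ht]
  · simp [ContactIsotopy.mul_at, h2 s hs, h2' s hs]

/-- Homotopy relative to the end points, as a congruence on the group of contact isotopies. -/
def homotopyCon (ξ : ∀ x : V, Submodule ℝ (TangentSpace 𝓘(ℝ, E) x)) : Con (ContactIsotopy ξ) where
  r := Homotopic
  iseqv := ⟨Homotopic.refl, Homotopic.symm, Homotopic.trans⟩
  mul' := Homotopic.mul

/-- The universal cover of the identity component `Cont₀(V, ξ)` of the group of contactomorphisms: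
smooth contact isotopies starting at the identity, up to homotopy relative to the end points. Its
group structure is induced by composition at each time. -/
abbrev UnivCont (ξ : ∀ x : V, Submodule ℝ (TangentSpace 𝓘(ℝ, E) x)) : Type _ :=
  (homotopyCon ξ).Quotient

/-- The element of the universal cover represented by a contact isotopy. -/
def ContactIsotopy.toUniv (φ : ContactIsotopy ξ) : UnivCont ξ := (φ : (homotopyCon ξ).Quotient)

/-- The velocity `(d/dt) φ_t(x)` at time `t ∈ [0,1]`, a tangent vector at `φ_t(x)`
(one-sided at `t = 0, 1`). -/
def ContactIsotopy.velocity (φ : ContactIsotopy ξ) (t : ℝ) (x : V) :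
    TangentSpace 𝓘(ℝ, E) (φ.at_ t x) :=
  mfderivWithin 𝓘(ℝ, ℝ) 𝓘(ℝ, E) (fun s : ℝ => φ.at_ s x) (Icc (0 : ℝ) 1) t (1 : ℝ)

/-! ### Contact Hamiltonians, the order, quasi-morphisms, subheavy and superheavy sets -/

variable [IsManifold 𝓘(ℝ, E) ∞ V]

/-- `h` is the contact Hamiltonian, with respect to `α`, of the contact isotopy `φ`, that is
`h_t(φ_t(x)) = α((d/dt) φ_t(x))` for all `t ∈ [0,1]` and `x ∈ V`. Since `φ` is a contact isotopy, this
determines `h` on `[0,1] × V` (and makes it smooth there), and it says that `φ` integrates the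
time-dependent contact vector field `X` with `α(X_t) = h_t`. On a closed manifold every smooth
`h` has exactly one such `φ`. -/
def IsGeneratedBy (α : ContactForm E V) (φ : ContactIsotopy α.contactStructure) (h : ℝ → V → ℝ) : Prop :=
  ∀ t ∈ Icc (0 : ℝ) 1, ∀ x : V, α.form (φ.at_ t x) (φ.velocity t x) = h t (φ.at_ t x)

/-- `id ⪯ a`: the element `a` is represented by a contact isotopy with nonnegative contact
Hamiltonian. -/
def IsNonneg (α : ContactForm E V) (a : UnivCont α.contactStructure) : Prop :=
  ∃ (h : ℝ → V → ℝ) (φ : ContactIsotopy α.contactStructure), IsGeneratedBy α φ h ∧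
    (∀ t ∈ Icc (0 : ℝ) 1, ∀ x, 0 ≤ h t x) ∧ φ.toUniv = a

/-- The relation `a ⪯ b`, that is `id ⪯ a⁻¹ b`. -/
def Precedes (α : ContactForm E V) (a b : UnivCont α.contactStructure) : Prop :=
  IsNonneg α (a⁻¹ * b)

/-- A non-zero homogeneous quasi-morphism on a group. -/
structure IsQuasimorphism {G : Type*} [Group G] (μ : G → ℝ) : Prop where
  bounded : ∃ D : ℝ, 0 < D ∧ ∀ a b : G, |μ (a * b) - μ a - μ b| ≤ D
  homogeneous : ∀ (a : G) (k : ℤ), μ (a ^ k) = k * μ a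
  nonzero : ∃ a : G, μ a ≠ 0

/-- A monotone (non-zero, homogeneous) quasi-morphism on the universal cover. -/
structure IsMonotoneQuasimorphism (α : ContactForm E V) (μ : UnivCont α.contactStructure → ℝ) : Prop
    extends IsQuasimorphism μ where
  monotone : ∀ a b, Precedes α a b → μ a ≤ μ b

/-- A closed set `Y` is `μ`-subheavy if `μ` vanishes on the elements generated by
autonomous smooth contact Hamiltonians that vanish on `Y`. -/
structure IsSubheavy (α : ContactForm E V) (μ : UnivCont α.contactStructure → ℝ) (Y : Set V) : Prop where
  isClosed : IsClosed Y
  eq_zero : ∀ h : V → ℝ, ContMDiff 𝓘(ℝ, E) 𝓘(ℝ, ℝ) ∞ h → (∀ y ∈ Y, h y = 0) →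
    ∀ φ : ContactIsotopy α.contactStructure, IsGeneratedBy α φ (fun _ => h) → μ φ.toUniv = 0

/-- A closed set `Y` is `μ`-superheavy if `μ` is positive on the elements generated by
autonomous smooth contact Hamiltonians that are positive on `Y`. -/
structure IsSuperheavy (α : ContactForm E V) (μ : UnivCont α.contactStructure → ℝ) (Y : Set V) :
    Prop where
  isClosed : IsClosed Y
  pos : ∀ h : V → ℝ, ContMDiff 𝓘(ℝ, E) 𝓘(ℝ, ℝ) ∞ h → (∀ y ∈ Y, 0 < h y) →
    ∀ φ : ContactIsotopy α.contactStructure, IsGeneratedBy α φ (fun _ => h) → 0 < μ φ.toUniv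

/-! ### Contact vector fields and their flows -/

/-- `θ` is the (global, smooth) flow of the vector field `X`. -/
structure IsFlow (X : ∀ x : V, TangentSpace 𝓘(ℝ, E) x) (θ : ℝ → V → V) : Prop where
  smooth : ContMDiff (𝓘(ℝ, ℝ).prod 𝓘(ℝ, E)) 𝓘(ℝ, E) ∞ (fun p : ℝ × V => θ p.1 p.2)
  zero : ∀ x, θ 0 x = x
  integral : ∀ x, IsMIntegralCurve (fun t => θ t x) X

/-- A contact vector field: a smooth vector field whose flow preserves `ξ`. (On a closed manifold
every smooth vector field has a flow.) -/
structure IsContactVectorField (ξ : ∀ x : V, Submodule ℝ (TangentSpace 𝓘(ℝ, E) x))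
    (X : ∀ x : V, TangentSpace 𝓘(ℝ, E) x) : Prop where
  smooth : ContMDiff 𝓘(ℝ, E) 𝓘(ℝ, E).tangent ∞
    (fun x => (⟨x, X x⟩ : TangentBundle 𝓘(ℝ, E) V))
  preserves : ∃ θ : ℝ → V → V, IsFlow X θ ∧ ∀ t, Preserves ξ (θ t)

end Definitions

end ContactQM

end

/-! Let `a` be the class generated by `h`, and let `T` be the class of the isotopy t ↦ θ_{ct}, whose
contact Hamiltonian is c·α(X). By compactness of Y, c > 0 can be chosen with c·α(X) < h on Y. Write
a = T r. Since Y is invariant under θ, the isotopy t ↦ θ_{ct}⁻¹φ_t representing r has nonnegative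
Hamiltonian on a neighbourhood of Y. The same holds for each conjugate T⁻ʲ r Tʲ, because conjugation
by a contactomorphism moves the Hamiltonian and rescales it by a positive factor
(`ContactIsotopy.exists_conformalFactor`).

Finitely many such conjugates lie above a single class `e` generated by an autonomous function
vanishing on Y (`IsSubheavy.exists_common_lower_bound`), and subheaviness gives μ(e) = 0. Regrouping
aᴺ = Tᴺ · (T⁻⁽ᴺ⁻¹⁾ r Tᴺ⁻¹) ⋯ (T⁻¹ r T) · r shows eᴺ ⪯ T⁻ᴺ aᴺ (`Precedes.pow_le_of_conj`), hence
μ(T⁻ᴺ aᴺ) ≥ 0. The class `e` depends on N, but the defect D is paid only once, so N μ(a) ≥ N μ(T) −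
D for every N, and therefore μ(a) ≥ μ(T). Finally μ(T) > 0: the flow is positive, so powers of T
dominate the whole group (`IsMonotoneQuasimorphism.pos_of_dominating`).

Two inputs need real work. The order must be bi-invariant (`Precedes.mul`) and detected by contact
Hamiltonians (`precedes_of_hamiltonian_le`). Subheaviness constrains isotopies that are already
given, so the isotopy representing `e` must be constructed (`exists_isGeneratedBy`). Its vector
field Z is found chart by chart from the linear system α(Z) = f, dα(Z,·) + df = gα, which by
Cartan's formula says that the Lie derivative of α along Z is gα. Its flow is smooth by an implicit
function argument in a space of curves (`exists_contDiffAt_flow`), and compactness makes it global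
(`exists_contact_flow`). -/

noncomputable section

namespace ContactQM

/-! ### Smooth dependence of solutions of ordinary differential equations -/

section SmoothODE

open Filter Topology MeasureTheory

universe u

/-- Evaluation of a continuous family of operators on a continuous family of vectors. -/
def applyFamily (K : Type*) [TopologicalSpace K] [CompactSpace K] (E F : Type u)
    [NormedAddCommGroup E] [NormedSpace ℝ E] [NormedAddCommGroup F] [NormedSpace ℝ F] :
    C(K, E →L[ℝ] F) →L[ℝ] C(K, E) →L[ℝ] C(K, F) :=
  LinearMap.mkContinuous₂
    (LinearMap.mk₂ ℝ (fun (A : C(K, E →L[ℝ] F)) (η : C(K, E)) =>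
      (⟨fun k => A k (η k), A.continuous.clm_apply η.continuous⟩ : C(K, F)))
      (fun _ _ _ => by ext; rfl) (fun _ _ _ => by ext; rfl)
      (fun _ _ _ => by ext; simp) (fun _ _ _ => by ext; simp)) 1
    (fun A η => by
      rw [one_mul]
      refine (ContinuousMap.norm_le _ (by positivity)).2 fun k => ?_
      exact ((A k).le_opNorm _).trans (mul_le_mul (A.norm_coe_le_norm k) (η.norm_coe_le_norm k)
        (norm_nonneg _) ((norm_nonneg _).trans (A.norm_coe_le_norm k))))

variable {K : Type*} [TopologicalSpace K] [CompactSpace K]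
  {E : Type u} [NormedAddCommGroup E] [NormedSpace ℝ E]

/-- The range of γ is compact, so g' is uniformly continuous around it, and the mean value
inequality gives an error bound independent of the point of K. -/
theorem hasFDerivAt_comp_continuousMap {F : Type u} [NormedAddCommGroup F] [NormedSpace ℝ F]
    (g : C(E, F)) (g' : C(E, E →L[ℝ] F)) (hg : ∀ x, HasFDerivAt g (g' x) x) (γ : C(K, E)) :
    HasFDerivAt (fun η : C(K, E) => g.comp η) (applyFamily K E F (g'.comp γ)) γ := by
  rw [hasFDerivAt_iff_isLittleO_nhds_zero, Asymptotics.isLittleO_iff]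
  intro ε hε
  have hcomp : IsCompact (range γ) := isCompact_range γ.continuous
  have h := hcomp.uniformContinuousAt_of_continuousAt g' (fun x _ => g'.continuous.continuousAt)
    (Metric.dist_mem_uniformity hε)
  obtain ⟨δ, hδ, hδ'⟩ := Metric.mem_uniformity_dist.1 h
  filter_upwards [Metric.ball_mem_nhds (0 : C(K, E)) hδ] with η hη
  rw [mem_ball_zero_iff] at hη
  refine (ContinuousMap.norm_le _ (by positivity)).2 fun k => ?_
  have hk : ‖η k‖ < δ := (η.norm_coe_le_norm k).trans_lt hη
  have := (convex_ball (γ k) δ).norm_image_sub_le_of_norm_hasFDerivWithin_le' (f := g) (f' := g')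
    (φ := g' (γ k)) (C := ε) (x := γ k) (y := γ k + η k)
    (fun x _ => (hg x).hasFDerivWithinAt) (fun x hx => by
      have h2 : dist (g' (γ k)) (g' x) < ε := by
        refine hδ' (a := γ k) (b := x) ?_ ⟨k, rfl⟩
        rw [dist_comm]; exact hx
      rw [← dist_eq_norm, dist_comm]; exact h2.le)
    (Metric.mem_ball_self hδ) (by simpa [Metric.mem_ball, dist_eq_norm] using hk)
  rw [add_sub_cancel_left] at this
  refine le_trans ?_ (this.trans (mul_le_mul_of_nonneg_left (η.norm_coe_le_norm k) hε.le))
  rfl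

/-- The derivative of postcomposition by g is, up to the bounded linear map `applyFamily`,
postcomposition by g', so induction applies with target E →L[ℝ] F. This change of target is why E
and F share a universe. -/
theorem contDiff_comp_continuousMap_nat (n : ℕ) {F : Type u} [NormedAddCommGroup F]
    [NormedSpace ℝ F] (g : C(E, F)) (hg : ContDiff ℝ n g) :
    ContDiff ℝ n (fun η : C(K, E) => g.comp η) := by
  induction n generalizing F with
  | zero =>
    rw [Nat.cast_zero, contDiff_zero]
    exact ContinuousMap.continuous_postcomp g
  | succ n ih =>
    have hg1 : ContDiff ℝ n (fderiv ℝ g) :=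
      hg.fderiv_right (m := n) (by norm_cast)
    let g' : C(E, E →L[ℝ] F) := ⟨fderiv ℝ g, hg1.continuous⟩
    have hd : ∀ x, HasFDerivAt g (g' x) x := fun x =>
      (hg.differentiable (by norm_cast) x).hasFDerivAt
    have := ih g' hg1
    push_cast
    rw [contDiff_succ_iff_hasFDerivAt]
    have hΦ : ContDiff ℝ n (applyFamily K E F) :=
      ContinuousLinearMap.contDiff (𝕜 := ℝ) (E := C(K, E →L[ℝ] F)) (F := C(K, E) →L[ℝ] C(K, F))
        (applyFamily K E F)
    exact ⟨fun γ => applyFamily K E F (g'.comp γ), hΦ.comp this, fun γ => hasFDerivAt_comp_continuousMap g g' hd γ⟩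

theorem contDiff_comp_continuousMap {F : Type u} [NormedAddCommGroup F]
    [NormedSpace ℝ F] (g : C(E, F)) (hg : ContDiff ℝ ∞ g) :
    ContDiff ℝ ∞ (fun η : C(K, E) => g.comp η) :=
  contDiff_infty.2 fun n => contDiff_comp_continuousMap_nat n g (hg.of_le (by exact_mod_cast le_top))


/-- The primitive vanishing at `0` of a continuous function on `[-1, 1]`. -/
def primitiveCLM (E : Type u) [NormedAddCommGroup E] [NormedSpace ℝ E] [CompleteSpace E] :
    C(Icc (-1 : ℝ) 1, E) →L[ℝ] C(Icc (-1 : ℝ) 1, E) :=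
  LinearMap.mkContinuous
    { toFun := fun η => ⟨fun s => ∫ r in (0 : ℝ)..s, IccExtend (by norm_num : (-1 : ℝ) ≤ 1) η r,
        (intervalIntegral.continuous_primitive
          (fun a b => (η.continuous.Icc_extend').intervalIntegrable a b) 0).comp
          continuous_subtype_val⟩
      map_add' := fun η ζ => by
        ext s
        exact intervalIntegral.integral_add ((η.continuous.Icc_extend').intervalIntegrable _ _)
          ((ζ.continuous.Icc_extend').intervalIntegrable _ _)
      map_smul' := fun c η => by
        ext s
        exact intervalIntegral.integral_smul c _ } 1 (fun η => by
      rw [one_mul]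
      refine (ContinuousMap.norm_le _ (by positivity)).2 fun s => ?_
      refine (intervalIntegral.norm_integral_le_of_norm_le_const (C := ‖η‖) fun r _ =>
        η.norm_coe_le_norm _).trans ?_
      rw [sub_zero]
      exact mul_le_of_le_one_right (norm_nonneg _) (abs_le.2 s.2))

/-- The equation `γ = x + t ∫ Z(γ)`, in the form `integralEquation Z ((t, x), γ) = 0`. -/
def integralEquation [CompleteSpace E] (Z : C(E, E)) (p : (ℝ × E) × C(Icc (-1 : ℝ) 1, E)) :
    C(Icc (-1 : ℝ) 1, E) :=
  p.2 - ContinuousLinearMap.const ℝ (Icc (-1 : ℝ) 1) p.1.2 - p.1.1 • primitiveCLM E (Z.comp p.2)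

theorem contDiff_integralEquation [CompleteSpace E] (Z : C(E, E)) (hZ : ContDiff ℝ ∞ Z) :
    ContDiff ℝ ∞ (integralEquation Z) := by
  unfold integralEquation
  have h1 : ContDiff ℝ ∞ (fun p : (ℝ × E) × C(Icc (-1 : ℝ) 1, E) => Z.comp p.2) :=
    (contDiff_comp_continuousMap Z hZ).comp contDiff_snd
  have h2 := (primitiveCLM E).contDiff.comp h1
  have h3 : ContDiff ℝ ∞ (fun p : (ℝ × E) × C(Icc (-1 : ℝ) 1, E) =>
      ContinuousLinearMap.const ℝ (Icc (-1 : ℝ) 1) p.1.2) :=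
    (ContinuousLinearMap.const ℝ (Icc (-1 : ℝ) 1) (M := E)).contDiff.comp
      (contDiff_snd.comp contDiff_fst)
  exact (contDiff_snd.sub h3).sub ((contDiff_fst.comp contDiff_fst).smul h2)

/-- The time t is a parameter of an equation for rescaled trajectories on [-1, 1]. At t = 0 the
equation is γ = x, with invertible derivative in γ, so the implicit function theorem gives a smooth
family Γ(t, x), and ψ(t, x) is its value at s = 1. The differential equation follows from local
uniqueness, which identifies Γ(ρs, x)(1) with Γ(ρ, x)(s). -/
theorem exists_contDiffAt_flow [CompleteSpace E] (Z : E → E) (hZ : ContDiff ℝ ∞ Z) (x₀ : E) :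
    ∃ ψ : ℝ × E → E, ContDiffAt ℝ ∞ ψ (0, x₀) ∧ ∀ᶠ p : ℝ × E in 𝓝 (0, x₀),
      ψ (0, p.2) = p.2 ∧ HasDerivAt (fun s => ψ (s, p.2)) (Z (ψ p)) p.1 := by
  let I := Icc (-1 : ℝ) 1
  let Zc : C(E, E) := ⟨Z, hZ.continuous⟩
  let c : E →L[ℝ] C(I, E) := ContinuousLinearMap.const ℝ I
  let F := integralEquation Zc
  let u : (ℝ × E) × C(I, E) := ((0, x₀), c x₀)
  have hF : ContDiffAt ℝ ∞ F u := (contDiff_integralEquation Zc hZ).contDiffAt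
  have hFu : F u = 0 := by
    simp only [F, u, integralEquation, c, zero_smul, sub_zero]
    exact sub_self _
  have hinv : (fderiv ℝ F u ∘L .inr ℝ (ℝ × E) C(I, E)).IsInvertible := by
    have h1 : fderiv ℝ F u ∘L .inr ℝ (ℝ × E) C(I, E) = ContinuousLinearMap.id ℝ C(I, E) := by
      have h2 : HasFDerivAt (fun γ : C(I, E) => F ((0, x₀), γ))
          (fderiv ℝ F u ∘L .inr ℝ (ℝ × E) C(I, E)) (c x₀) :=
        HasFDerivAt.comp (c x₀) (hF.differentiableAt (by simp)).hasFDerivAt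
          (hasFDerivAt_prodMk_right (0, x₀) (c x₀))
      have h3 : HasFDerivAt (fun γ : C(I, E) => F ((0, x₀), γ))
          (ContinuousLinearMap.id ℝ C(I, E)) (c x₀) := by
        have : (fun γ : C(I, E) => F ((0, x₀), γ)) = fun γ => γ - c x₀ := by
          funext γ
          simp only [F, integralEquation, zero_smul, sub_zero]
          rfl
        rw [this]
        exact (hasFDerivAt_id _).sub_const _
      exact h2.unique h3
    rw [h1]
    exact ⟨ContinuousLinearEquiv.refl ℝ _, rfl⟩
  have hn : (∞ : WithTop ℕ∞) ≠ 0 := by simp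
  let Γ := hF.implicitFunction hn hinv
  have hΓ : ContDiffAt ℝ ∞ Γ (0, x₀) := hF.contDiffAt_implicitFunction hn hinv
  have hΓ0 : Γ (0, x₀) = c x₀ := hF.implicitFunction_apply_self hn hinv
  have hA : ∀ᶠ p in 𝓝 ((0 : ℝ), x₀), F (p, Γ p) = 0 := by
    have := hF.eventually_apply_implicitFunction hn hinv
    rwa [hFu] at this
  have hB : ∀ᶠ v in 𝓝 u, F v = 0 ↔ Γ v.1 = v.2 := by
    have := hF.eventually_apply_eq_iff_implicitFunction hn hinv
    rwa [hFu] at this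
  let e1 : I := ⟨1, by norm_num, le_rfl⟩
  refine ⟨fun p => Γ p e1, ?_, ?_⟩
  · exact (ContinuousMap.evalCLM ℝ e1).contDiff.contDiffAt.comp _ hΓ
  obtain ⟨δ, hδ, hBδ⟩ := Metric.eventually_nhds_iff.1 hB
  have hcont : ∀ᶠ p in 𝓝 ((0 : ℝ), x₀), dist (Γ p) (c x₀) < δ := by
    have := hΓ.continuousAt
    rw [ContinuousAt, hΓ0] at this
    exact this (Metric.ball_mem_nhds _ hδ)
  obtain ⟨ε, hε, hAε⟩ := Metric.eventually_nhds_iff.1 (hA.and hcont)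
  -- Below ε the curve Γ solves the equation and is δ-close to the constant curve; within δ of the
  -- base point, solutions are unique.
  set ρ := min ε δ / 2 with hρ
  have hρ0 : 0 < ρ := by positivity
  have hρε : ρ < ε := by have := min_le_left ε δ; have := lt_min hε hδ; linarith
  have hρδ : ρ < δ := by have := min_le_right ε δ; have := lt_min hε hδ; linarith
  -- the solution for time `ρ`, rescaled, is the solution for time `ρ s`
  have key : ∀ x, dist x x₀ < ρ → ∀ s : I,
      Γ (ρ * s, x) e1 = Γ (ρ, x) s ∧
      Γ (ρ, x) s = x + ρ • ∫ r in (0 : ℝ)..s,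
        Z (IccExtend (by norm_num : (-1 : ℝ) ≤ 1) (Γ (ρ, x)) r) := by
    intro x hx s
    have hp : dist (ρ, x) ((0 : ℝ), x₀) < ε := by
      rw [Prod.dist_eq]
      refine max_lt ?_ (hx.trans hρε)
      simpa [Real.dist_eq, abs_of_pos hρ0] using hρε
    obtain ⟨hz, hd⟩ := hAε hp
    have heq : ∀ s : I, Γ (ρ, x) s = x + ρ • ∫ r in (0 : ℝ)..s,
        Z (IccExtend (by norm_num : (-1 : ℝ) ≤ 1) (Γ (ρ, x)) r) := by
      intro s
      have h1 := congrArg (fun g : C(I, E) => g s) hz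
      have h2 : Γ (ρ, x) s - x - ρ • ∫ r in (0 : ℝ)..s,
        Z (IccExtend (by norm_num : (-1 : ℝ) ≤ 1) (Γ (ρ, x)) r) = 0 := h1
      rw [sub_sub, sub_eq_zero] at h2
      exact h2
    refine ⟨?_, heq s⟩
    have hmem : ∀ r : I, (s : ℝ) * r ∈ I := fun r => by
      have h1 : |(s : ℝ) * r| ≤ 1 := by
        rw [abs_mul]
        exact mul_le_one₀ (abs_le.2 s.2) (abs_nonneg _) (abs_le.2 r.2)
      exact abs_le.1 h1
    -- The trajectory for time ρ, slowed down by the factor s, solves the equation for time ρs and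
    -- stays near the constant curve, so uniqueness identifies it with Γ(ρs, x).
    let σ : C(I, E) := ⟨fun r => Γ (ρ, x) ⟨s * r, hmem r⟩, by fun_prop⟩
    have hσd : dist σ (c x₀) < δ :=
      (ContinuousMap.dist_lt_iff hδ).2 fun r => (ContinuousMap.dist_lt_iff hδ).1 hd ⟨s * r, hmem r⟩
    have hσ : F ((ρ * s, x), σ) = 0 := by
      ext r
      change Γ (ρ, x) ⟨s * r, hmem r⟩ - x - (ρ * s) • ∫ q in (0 : ℝ)..r,
        Z (IccExtend (by norm_num : (-1 : ℝ) ≤ 1) σ q) = 0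
      rw [heq, mul_smul, sub_sub, sub_eq_zero]
      congr 2
      have h1 : ∫ q in (0 : ℝ)..r, Z (IccExtend (by norm_num : (-1 : ℝ) ≤ 1) σ q)
          = ∫ q in (0 : ℝ)..r, Z (IccExtend (by norm_num : (-1 : ℝ) ≤ 1) (Γ (ρ, x)) (s * q)) := by
        refine intervalIntegral.integral_congr fun q hq => ?_
        have hq' : q ∈ I := by
          refine (uIcc_subset_Icc ?_ r.2) hq
          exact ⟨by norm_num, by norm_num⟩
        have h3 : (s : ℝ) * q ∈ I := hmem ⟨q, hq'⟩
        change Z _ = Z _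
        rw [IccExtend_of_mem _ _ hq', IccExtend_of_mem _ _ h3]
        rfl
      rw [h1, intervalIntegral.smul_integral_comp_mul_left
        (fun q => Z (IccExtend (by norm_num : (-1 : ℝ) ≤ 1) (Γ (ρ, x)) q))]
      simp
    have hclose : dist ((ρ * s, x), σ) u < δ := by
      rw [Prod.dist_eq, Prod.dist_eq]
      refine max_lt (max_lt ?_ (hx.trans hρδ)) hσd
      rw [Real.dist_eq, sub_zero, abs_mul, abs_of_pos hρ0]
      exact (mul_le_of_le_one_right hρ0.le (abs_le.2 s.2)).trans_lt hρδ
    have h4 := (hBδ hclose).1 hσ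
    change Γ (ρ * s, x) = σ at h4
    rw [h4]
    change Γ (ρ, x) ⟨s * 1, _⟩ = _
    congr 1
    exact Subtype.ext (mul_one _)
  rw [Metric.eventually_nhds_iff]
  refine ⟨ρ, hρ0, fun p hp => ?_⟩
  obtain ⟨t, x⟩ := p
  rw [Prod.dist_eq, max_lt_iff] at hp
  obtain ⟨ht, hx⟩ := hp
  rw [Real.dist_eq, sub_zero] at ht
  change |t| < ρ at ht
  have hform : ∀ s, |s| < ρ → Γ (s, x) e1 = x + ρ • ∫ r in (0 : ℝ)..(s / ρ),
        Z (IccExtend (by norm_num : (-1 : ℝ) ≤ 1) (Γ (ρ, x)) r) := by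
    intro s hs
    have hm : s / ρ ∈ I := by
      refine abs_le.1 ?_
      rw [abs_div, abs_of_pos hρ0, div_le_one hρ0]
      exact hs.le
    obtain ⟨h1, h2⟩ := key x hx ⟨s / ρ, hm⟩
    rw [h2] at h1
    rw [← h1]
    congr 2
    field_simp
  refine ⟨?_, ?_⟩
  · change Γ (0, x) e1 = x
    rw [hform 0 (by simpa using hρ0)]
    simp
  · change HasDerivAt (fun s => Γ (s, x) e1) (Z (Γ (t, x) e1)) t
    have hc : Continuous fun r => Z (IccExtend (by norm_num : (-1 : ℝ) ≤ 1) (Γ (ρ, x)) r) :=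
      hZ.continuous.comp ((Γ (ρ, x)).continuous.Icc_extend')
    have h1 : HasDerivAt (fun s => x + ρ • ∫ r in (0 : ℝ)..(s / ρ),
        Z (IccExtend (by norm_num : (-1 : ℝ) ≤ 1) (Γ (ρ, x)) r))
        (ρ • ((1 / ρ) • Z (IccExtend (by norm_num : (-1 : ℝ) ≤ 1) (Γ (ρ, x)) (t / ρ)))) t := by
      refine HasDerivAt.const_add x (HasDerivAt.const_smul ρ ?_)
      have h2 := intervalIntegral.integral_hasDerivAt_right (hc.intervalIntegrable 0 (t / ρ))
        (hc.stronglyMeasurableAtFilter _ _) hc.continuousAt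
      have h3 : HasDerivAt (fun s : ℝ => s / ρ) (1 / ρ) t := (hasDerivAt_id t).div_const ρ
      exact HasDerivAt.scomp t h2 h3
    have hm : t / ρ ∈ I := by
      refine abs_le.1 ?_
      rw [abs_div, abs_of_pos hρ0, div_le_one hρ0]
      exact ht.le
    have h5 : Z (Γ (t, x) e1)
        = ρ • ((1 / ρ) • Z (IccExtend (by norm_num : (-1 : ℝ) ≤ 1) (Γ (ρ, x)) (t / ρ))) := by
      rw [smul_smul, mul_one_div_cancel hρ0.ne', one_smul, IccExtend_of_mem _ _ hm]
      rw [← (key x hx ⟨t / ρ, hm⟩).1]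
      congr 4
      field_simp
    rw [h5]
    refine h1.congr_of_eventuallyEq ?_
    have : ∀ᶠ s in 𝓝 t, |s| < ρ := (continuous_abs.tendsto t).eventually (gt_mem_nhds ht)
    exact this.mono hform

end SmoothODE

/-! ### Velocities of contact isotopies -/

section IsotopyCalculus

open Filter Topology

variable {E : Type*} [NormedAddCommGroup E] [NormedSpace ℝ E]
  {V : Type*} [TopologicalSpace V] [ChartedSpace E V]

theorem uniqueMDiffWithinAt_unitInterval {t : ℝ} (ht : t ∈ Icc (0 : ℝ) 1) :
    UniqueMDiffWithinAt 𝓘(ℝ, ℝ) (Icc (0 : ℝ) 1) t :=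
  (uniqueDiffOn_Icc zero_lt_one t ht).uniqueMDiffWithinAt

theorem uniqueMDiffOn_unitInterval_prod :
    UniqueMDiffOn (𝓘(ℝ, ℝ).prod 𝓘(ℝ, E)) (Icc (0 : ℝ) 1 ×ˢ (univ : Set V)) :=
  (uniqueDiffOn_Icc zero_lt_one).uniqueMDiffOn.prod uniqueMDiffOn_univ

section Family

variable {F : ℝ → Equiv.Perm V}

theorem IsSmoothFamily.hasMFDerivWithinAt (hF : IsSmoothFamily (E := E) (Icc (0 : ℝ) 1) F) {t : ℝ}
    (ht : t ∈ Icc (0 : ℝ) 1) (x : V) :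
    ∃ D : ℝ × E →L[ℝ] E,
      HasMFDerivWithinAt (𝓘(ℝ, ℝ).prod 𝓘(ℝ, E)) 𝓘(ℝ, E) (fun p : ℝ × V => F p.1 p.2)
        (Icc (0 : ℝ) 1 ×ˢ univ) (t, x) D :=
  ⟨_, ((hF.1 (t, x) ⟨ht, mem_univ _⟩).mdifferentiableWithinAt (by simp)).hasMFDerivWithinAt⟩

/-- The chain rule for `s ↦ F s (c s)`. -/
theorem IsSmoothFamily.mfderivWithin_comp_curve (hF : IsSmoothFamily (E := E) (Icc (0 : ℝ) 1) F)
    {t : ℝ} (ht : t ∈ Icc (0 : ℝ) 1) {c : ℝ → V}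
    (hc : MDifferentiableWithinAt 𝓘(ℝ, ℝ) 𝓘(ℝ, E) c (Icc (0 : ℝ) 1) t) :
    (mfderivWithin 𝓘(ℝ, ℝ) 𝓘(ℝ, E) (fun s => F s (c s)) (Icc (0 : ℝ) 1) t (1 : ℝ) : E)
      = (mfderivWithin 𝓘(ℝ, ℝ) 𝓘(ℝ, E) (fun s => F s (c t)) (Icc (0 : ℝ) 1) t (1 : ℝ) : E)
        + (mfderiv 𝓘(ℝ, E) 𝓘(ℝ, E) (F t) (c t)
          (mfderivWithin 𝓘(ℝ, ℝ) 𝓘(ℝ, E) c (Icc (0 : ℝ) 1) t (1 : ℝ) : E) : E) := by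
  obtain ⟨D, hD⟩ := hF.hasMFDerivWithinAt ht (c t)
  have hu := uniqueMDiffWithinAt_unitInterval ht
  have hc' := hc.hasMFDerivWithinAt
  set c' : ℝ →L[ℝ] E := mfderivWithin 𝓘(ℝ, ℝ) 𝓘(ℝ, E) c (Icc (0 : ℝ) 1) t with hc'def
  have h1 : HasMFDerivWithinAt 𝓘(ℝ, ℝ) 𝓘(ℝ, E) (fun s => F s (c s)) (Icc (0 : ℝ) 1) t
      (D.comp ((ContinuousLinearMap.id ℝ ℝ).prod c')) :=
    HasMFDerivWithinAt.comp (I' := 𝓘(ℝ, ℝ).prod 𝓘(ℝ, E)) (f := fun s => (s, c s)) t hD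
      ((hasMFDerivWithinAt_id _ t).prodMk hc') (fun s hs => ⟨hs, mem_univ _⟩)
  have h2 : HasMFDerivWithinAt 𝓘(ℝ, ℝ) 𝓘(ℝ, E) (fun s => F s (c t)) (Icc (0 : ℝ) 1) t
      (D.comp ((ContinuousLinearMap.id ℝ ℝ).prod 0)) :=
    HasMFDerivWithinAt.comp (I' := 𝓘(ℝ, ℝ).prod 𝓘(ℝ, E)) (f := fun s => (s, c t)) t hD
      ((hasMFDerivWithinAt_id _ t).prodMk (hasMFDerivWithinAt_const _ _ _))
      (fun s hs => ⟨hs, mem_univ _⟩)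
  have h3 : HasMFDerivAt 𝓘(ℝ, E) 𝓘(ℝ, E) (F t) (c t)
      (D.comp ((0 : E →L[ℝ] ℝ).prod (ContinuousLinearMap.id ℝ E))) := by
    exact hasMFDerivWithinAt_univ.1 <| HasMFDerivWithinAt.comp (I' := 𝓘(ℝ, ℝ).prod 𝓘(ℝ, E)) (f := fun z => (t, z)) (c t) hD
      ((hasMFDerivWithinAt_const _ _ _).prodMk (hasMFDerivWithinAt_id _ _))
      (fun s hs => ⟨ht, mem_univ _⟩)
  have e1 := h1.mfderivWithin hu
  have e2 := h2.mfderivWithin hu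
  have e3 := h3.mfderiv
  rw [e1, e2, e3]
  change D (1, c' 1) = D (1, 0) + D (0, c' 1)
  rw [← map_add]; simp

end Family

variable {ξ : ∀ x : V, Submodule ℝ (TangentSpace 𝓘(ℝ, E) x)}

theorem ContactIsotopy.mdifferentiableWithinAt (φ : ContactIsotopy ξ) {t : ℝ}
    (ht : t ∈ Icc (0 : ℝ) 1) (x : V) :
    MDifferentiableWithinAt 𝓘(ℝ, ℝ) 𝓘(ℝ, E) (fun s => φ.at_ s x) (Icc (0 : ℝ) 1) t := by
  obtain ⟨D, hD⟩ := φ.smooth.hasMFDerivWithinAt ht x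
  exact (HasMFDerivWithinAt.comp (I' := 𝓘(ℝ, ℝ).prod 𝓘(ℝ, E)) (f := fun s => (s, x)) t hD
      ((hasMFDerivWithinAt_id _ t).prodMk (hasMFDerivWithinAt_const _ _ _))
      (fun s hs => ⟨hs, mem_univ _⟩)).mdifferentiableWithinAt

theorem ContactIsotopy.mdifferentiableAt (φ : ContactIsotopy ξ) {t : ℝ}
    (ht : t ∈ Icc (0 : ℝ) 1) (x : V) : MDifferentiableAt 𝓘(ℝ, E) 𝓘(ℝ, E) (φ.at_ t) x :=
  (φ.smooth.contMDiff ht).mdifferentiable (by simp) x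

theorem ContactIsotopy.velocity_mul (φ ψ : ContactIsotopy ξ) {t : ℝ} (ht : t ∈ Icc (0 : ℝ) 1)
    (x : V) : ((φ * ψ).velocity t x : E) = (φ.velocity t (ψ.at_ t x) : E)
      + (mfderiv 𝓘(ℝ, E) 𝓘(ℝ, E) (φ.at_ t) (ψ.at_ t x) (ψ.velocity t x) : E) :=
  φ.smooth.mfderivWithin_comp_curve ht (ψ.mdifferentiableWithinAt ht x)

variable [IsManifold 𝓘(ℝ, E) ∞ V] (α : ContactForm E V)

theorem ContactForm.contMDiff_apply :
    ContMDiff 𝓘(ℝ, E).tangent 𝓘(ℝ, ℝ) ∞ (fun p : TangentBundle 𝓘(ℝ, E) V => α.form p.1 p.2) := by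
  have hv : ContMDiff 𝓘(ℝ, E).tangent 𝓘(ℝ, E).tangent ∞
      (fun p : TangentBundle 𝓘(ℝ, E) V => p) := contMDiff_id
  have hp : ContMDiff 𝓘(ℝ, E).tangent 𝓘(ℝ, E) ∞ (fun p : TangentBundle 𝓘(ℝ, E) V => p.1) :=
    Bundle.contMDiff_proj _
  have hϕ := α.contMDiff.comp hp
  have h : ContMDiff 𝓘(ℝ, E).tangent (𝓘(ℝ, E).prod 𝓘(ℝ, ℝ)) ∞
      (fun p : TangentBundle 𝓘(ℝ, E) V =>
        Bundle.TotalSpace.mk' ℝ (E := Bundle.Trivial V ℝ) p.1 (α.form p.1 p.2)) := by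
    intro p
    exact ContMDiffWithinAt.clm_bundle_apply (F₁ := E) (F₂ := ℝ)
      (E₁ := fun x : V => TangentSpace 𝓘(ℝ, E) x) (E₂ := Bundle.Trivial V ℝ) (s := univ)
      (b := fun p : TangentBundle 𝓘(ℝ, E) V => p.1) (v := fun p => p.2)
      (ϕ := fun p => α.form p.1) (hϕ p) (hv p)
  intro p
  exact (Bundle.contMDiffAt_totalSpace.1 (h p)).2

theorem ContactForm.continuous_apply :
    Continuous (fun p : TangentBundle 𝓘(ℝ, E) V => α.form p.1 p.2) :=
  α.contMDiff_apply.continuous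

/-- The contact Hamiltonian of a contact isotopy, pulled back to the initial point: the value of `α`
on the velocity. -/
def ContactIsotopy.alphaVelocity (φ : ContactIsotopy α.contactStructure) (t : ℝ) (x : V) : ℝ :=
  α.form (φ.at_ t x) (φ.velocity t x)

/-- The value of `α` on the image of the tangent vector `v` at `x` under the isotopy. -/
def ContactIsotopy.alphaDeriv (φ : ContactIsotopy α.contactStructure) (t : ℝ) (x : V)
    (v : TangentSpace 𝓘(ℝ, E) x) : ℝ :=
  α.form (φ.at_ t x) (mfderiv 𝓘(ℝ, E) 𝓘(ℝ, E) (φ.at_ t) x v)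

variable {α}

theorem ContactIsotopy.alphaVelocity_mul (φ ψ : ContactIsotopy α.contactStructure) {t : ℝ}
    (ht : t ∈ Icc (0 : ℝ) 1) (x : V) :
    (φ * ψ).alphaVelocity α t x
      = φ.alphaVelocity α t (ψ.at_ t x) + φ.alphaDeriv α t (ψ.at_ t x) (ψ.velocity t x) := by
  have h := congrArg (fun w : E => (α.form (φ.at_ t (ψ.at_ t x)) : E →L[ℝ] ℝ) w)
    (φ.velocity_mul ψ ht x)
  exact h.trans (map_add (α.form (φ.at_ t (ψ.at_ t x)) : E →L[ℝ] ℝ) _ _)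

theorem ContactIsotopy.continuousOn_tangentMap (φ : ContactIsotopy α.contactStructure) :
    ContinuousOn (fun q : TangentBundle 𝓘(ℝ, ℝ) ℝ × TangentBundle 𝓘(ℝ, E) V =>
      tangentMapWithin (𝓘(ℝ, ℝ).prod 𝓘(ℝ, E)) 𝓘(ℝ, E) (fun p : ℝ × V => φ.at_ p.1 p.2)
        (Icc (0 : ℝ) 1 ×ˢ univ) ((equivTangentBundleProd 𝓘(ℝ, ℝ) ℝ 𝓘(ℝ, E) V).symm q))
      {q | q.1.1 ∈ Icc (0 : ℝ) 1} := by
  have h := φ.smooth.1.continuousOn_tangentMapWithin (by simp) uniqueMDiffOn_unitInterval_prod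
  have h2 : Continuous (equivTangentBundleProd 𝓘(ℝ, ℝ) ℝ 𝓘(ℝ, E) V).symm :=
    (contMDiff_equivTangentBundleProd_symm (n := 0)).continuous
  exact h.comp h2.continuousOn (fun q hq => ⟨hq, mem_univ _⟩)

/-- Passing through the tangent map of (t, x) ↦ φ_t(x), on vectors with zero time component,
exhibits continuity in t. -/
theorem ContactIsotopy.alphaDeriv_eq (φ : ContactIsotopy α.contactStructure) {t : ℝ}
    (ht : t ∈ Icc (0 : ℝ) 1) (p : TangentBundle 𝓘(ℝ, E) V) :
    φ.alphaDeriv α t p.1 p.2 = (fun p : TangentBundle 𝓘(ℝ, E) V => α.form p.1 p.2)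
      (tangentMapWithin (𝓘(ℝ, ℝ).prod 𝓘(ℝ, E)) 𝓘(ℝ, E) (fun p : ℝ × V => φ.at_ p.1 p.2)
        (Icc (0 : ℝ) 1 ×ˢ univ) ((equivTangentBundleProd 𝓘(ℝ, ℝ) ℝ 𝓘(ℝ, E) V).symm
          (⟨t, (0 : ℝ)⟩, p))) := by
  obtain ⟨D, hD⟩ := φ.smooth.hasMFDerivWithinAt ht p.1
  have h3 : HasMFDerivAt 𝓘(ℝ, E) 𝓘(ℝ, E) (φ.at_ t) p.1
      (D.comp ((0 : E →L[ℝ] ℝ).prod (ContinuousLinearMap.id ℝ E))) :=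
    hasMFDerivWithinAt_univ.1 <| HasMFDerivWithinAt.comp (I' := 𝓘(ℝ, ℝ).prod 𝓘(ℝ, E))
      (f := fun z => (t, z)) p.1 hD
      ((hasMFDerivWithinAt_const _ _ _).prodMk (hasMFDerivWithinAt_id _ _))
      (fun s hs => ⟨ht, mem_univ _⟩)
  have e3 := h3.mfderiv
  have e := hD.mfderivWithin (uniqueMDiffOn_unitInterval_prod (t, p.1) ⟨ht, mem_univ _⟩)
  change (α.form (φ.at_ t p.1) : E →L[ℝ] ℝ) (mfderiv 𝓘(ℝ, E) 𝓘(ℝ, E) (φ.at_ t) p.1 p.2)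
    = (α.form (φ.at_ t p.1) : E →L[ℝ] ℝ) (mfderivWithin (𝓘(ℝ, ℝ).prod 𝓘(ℝ, E)) 𝓘(ℝ, E)
      (fun p : ℝ × V => φ.at_ p.1 p.2) (Icc (0 : ℝ) 1 ×ˢ univ) (t, p.1) ((0 : ℝ), (p.2 : E)))
  rw [e3, e]
  rfl

/-- The velocity is the image of the unit time vector with zero space component, which gives joint
continuity in (t, x). -/
theorem ContactIsotopy.alphaVelocity_eq (φ : ContactIsotopy α.contactStructure) {t : ℝ}
    (ht : t ∈ Icc (0 : ℝ) 1) (x : V) :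
    φ.alphaVelocity α t x = (fun p : TangentBundle 𝓘(ℝ, E) V => α.form p.1 p.2)
      (tangentMapWithin (𝓘(ℝ, ℝ).prod 𝓘(ℝ, E)) 𝓘(ℝ, E) (fun p : ℝ × V => φ.at_ p.1 p.2)
        (Icc (0 : ℝ) 1 ×ˢ univ) ((equivTangentBundleProd 𝓘(ℝ, ℝ) ℝ 𝓘(ℝ, E) V).symm
          (⟨t, (1 : ℝ)⟩, ⟨x, (0 : E)⟩))) := by
  obtain ⟨D, hD⟩ := φ.smooth.hasMFDerivWithinAt ht x
  have h2 : HasMFDerivWithinAt 𝓘(ℝ, ℝ) 𝓘(ℝ, E) (fun s => φ.at_ s x) (Icc (0 : ℝ) 1) t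
      (D.comp ((ContinuousLinearMap.id ℝ ℝ).prod 0)) :=
    HasMFDerivWithinAt.comp (I' := 𝓘(ℝ, ℝ).prod 𝓘(ℝ, E)) (f := fun s => (s, x)) t hD
      ((hasMFDerivWithinAt_id _ t).prodMk (hasMFDerivWithinAt_const _ _ _))
      (fun s hs => ⟨hs, mem_univ _⟩)
  have e3 := h2.mfderivWithin (uniqueMDiffWithinAt_unitInterval ht)
  have e := hD.mfderivWithin (uniqueMDiffOn_unitInterval_prod (t, x) ⟨ht, mem_univ _⟩)
  change (α.form (φ.at_ t x) : E →L[ℝ] ℝ)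
    (mfderivWithin 𝓘(ℝ, ℝ) 𝓘(ℝ, E) (fun s => φ.at_ s x) (Icc (0 : ℝ) 1) t (1 : ℝ))
    = (α.form (φ.at_ t x) : E →L[ℝ] ℝ) (mfderivWithin (𝓘(ℝ, ℝ).prod 𝓘(ℝ, E)) 𝓘(ℝ, E)
      (fun p : ℝ × V => φ.at_ p.1 p.2) (Icc (0 : ℝ) 1 ×ˢ univ) (t, x) ((1 : ℝ), (0 : E)))
  rw [e3, e]
  rfl

theorem continuous_tangentBundle_mk_const {M : Type*} [NormedAddCommGroup M] [NormedSpace ℝ M]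
    (v : M) : Continuous (fun t : M => (⟨t, v⟩ : TangentBundle 𝓘(ℝ, M) M)) := by
  have h := (tangentBundleModelSpaceHomeomorph 𝓘(ℝ, M)).symm.continuous
  exact h.comp (continuous_id.prodMk continuous_const)

theorem ContactIsotopy.continuousOn_alphaDeriv (φ : ContactIsotopy α.contactStructure)
    (p : TangentBundle 𝓘(ℝ, E) V) :
    ContinuousOn (fun t => φ.alphaDeriv α t p.1 p.2) (Icc (0 : ℝ) 1) := by
  have h := α.continuous_apply.comp_continuousOn φ.continuousOn_tangentMap
  have hc : Continuous (fun t : ℝ => ((⟨t, (0 : ℝ)⟩, p) :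
      TangentBundle 𝓘(ℝ, ℝ) ℝ × TangentBundle 𝓘(ℝ, E) V)) :=
    (continuous_tangentBundle_mk_const (0 : ℝ)).prodMk continuous_const
  refine (h.comp hc.continuousOn (fun t ht => ht)).congr fun t ht => ?_
  exact φ.alphaDeriv_eq ht p

theorem ContactIsotopy.continuousOn_alphaVelocity (φ : ContactIsotopy α.contactStructure) :
    ContinuousOn (fun p : ℝ × V => φ.alphaVelocity α p.1 p.2) (Icc (0 : ℝ) 1 ×ˢ univ) := by
  have h := α.continuous_apply.comp_continuousOn φ.continuousOn_tangentMap
  have hz : Continuous (fun x : V => (⟨x, (0 : E)⟩ : TangentBundle 𝓘(ℝ, E) V)) :=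
    (Bundle.contMDiff_zeroSection (IB := 𝓘(ℝ, E)) (n := 0) ℝ
      (fun x : V => TangentSpace 𝓘(ℝ, E) x)).continuous
  have hc : Continuous (fun p : ℝ × V => ((⟨p.1, (1 : ℝ)⟩, ⟨p.2, (0 : E)⟩) :
      TangentBundle 𝓘(ℝ, ℝ) ℝ × TangentBundle 𝓘(ℝ, E) V)) :=
    ((continuous_tangentBundle_mk_const (1 : ℝ)).comp continuous_fst).prodMk
      (hz.comp continuous_snd)
  refine (h.comp hc.continuousOn (fun p hp => hp.1)).congr fun p hp => ?_
  exact φ.alphaVelocity_eq hp.1 p.2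

theorem ContactIsotopy.exists_bound_alphaVelocity [CompactSpace V]
    (φ : ContactIsotopy α.contactStructure) :
    ∃ C : ℝ, ∀ t ∈ Icc (0 : ℝ) 1, ∀ x, |φ.alphaVelocity α t x| ≤ C := by
  obtain ⟨C, hC⟩ := (isCompact_Icc.prod isCompact_univ).exists_bound_of_continuousOn
    φ.continuousOn_alphaVelocity
  exact ⟨C, fun t ht x => hC (t, x) ⟨ht, mem_univ _⟩⟩

/-- Contact isotopies preserve the coorientation: `φ_t^* α` is a positive multiple of `α`. -/
theorem ContactIsotopy.exists_conformalFactor (φ : ContactIsotopy α.contactStructure) {t : ℝ}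
    (ht : t ∈ Icc (0 : ℝ) 1) (x : V) :
    ∃ l : ℝ, 0 < l ∧ ∀ v, φ.alphaDeriv α t x v = l * α.form x v := by
  obtain ⟨w, hw⟩ : ∃ w : TangentSpace 𝓘(ℝ, E) x, α.form x w ≠ 0 := by
    by_contra! h
    exact α.ne_zero x (ContinuousLinearMap.ext h)
  set R : TangentSpace 𝓘(ℝ, E) x := (α.form x w)⁻¹ • w with hR
  have hR1 : α.form x R = 1 := by
    rw [hR, map_smul, smul_eq_mul, inv_mul_cancel₀ hw]
  -- A zero would put R in ker α, although α(R) = 1. The factor equals 1 at time 0, so the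
  -- intermediate value theorem keeps it positive.
  have hne : ∀ s ∈ Icc (0 : ℝ) 1, φ.alphaDeriv α s x R ≠ 0 := by
    intro s hs h0
    have h1 : R ∈ α.contactStructure x := (φ.contact s hs x R).1 h0
    have h2 : α.form x R = 0 := h1
    rw [hR1] at h2
    exact one_ne_zero h2
  have h0 : φ.alphaDeriv α 0 x R = 1 := by
    have h : ∀ f : V → V, f = id → α.form (f x) (mfderiv 𝓘(ℝ, E) 𝓘(ℝ, E) f x R) = α.form x R := by
      rintro f rfl
      rw [mfderiv_id]; rfl
    rw [← hR1]
    refine h _ ?_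
    rw [φ.zero]; rfl
  have hpos : 0 < φ.alphaDeriv α t x R := by
    by_contra! hneg
    have hcont : ContinuousOn (fun s => φ.alphaDeriv α s x R) (Icc 0 t) :=
      (φ.continuousOn_alphaDeriv ⟨x, R⟩).mono (Icc_subset_Icc_right ht.2)
    obtain ⟨s, hs, hs0⟩ := intermediate_value_Icc' ht.1 hcont
      (show (0 : ℝ) ∈ Icc _ _ from ⟨hneg, by rw [h0]; exact zero_le_one⟩)
    exact hne s ⟨hs.1, hs.2.trans ht.2⟩ hs0
  refine ⟨_, hpos, fun v => ?_⟩
  have hker : v - α.form x v • R ∈ α.contactStructure x := by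
    change α.form x (v - α.form x v • R) = 0
    rw [map_sub, map_smul, hR1, smul_eq_mul, mul_one, sub_self]
  have h1 : α.form (φ.at_ t x)
      (mfderiv 𝓘(ℝ, E) 𝓘(ℝ, E) (φ.at_ t) x (v - α.form x v • R)) = 0 := (φ.contact t ht x _).2 hker
  rw [map_sub, map_smul, map_sub, map_smul, sub_eq_zero, smul_eq_mul, mul_comm] at h1
  exact h1

end IsotopyCalculus

/-! ### The order on the universal cover -/

section Order

variable {E : Type*} [NormedAddCommGroup E] [NormedSpace ℝ E]
  {V : Type*} [TopologicalSpace V] [ChartedSpace E V]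

section Conjugation

variable {ξ : ∀ x : V, Submodule ℝ (TangentSpace 𝓘(ℝ, E) x)}

/-- The isotopy `t ↦ ψ_{c(t)} φ_t ψ_{c(t)}⁻¹`. -/
def ContactIsotopy.conjAlong (ψ φ : ContactIsotopy ξ) (c : ℝ → ℝ) (hc : ContDiff ℝ ∞ c)
    (hm : MapsTo c (Icc (0 : ℝ) 1) (Icc (0 : ℝ) 1)) : ContactIsotopy ξ where
  at_ t := ψ.at_ (c t) * φ.at_ t * (ψ.at_ (c t))⁻¹
  smooth := ((ψ.smooth.comp c hc hm).mul φ.smooth).mul (ψ.smooth.comp c hc hm).inv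
  zero := by simp [φ.zero]
  contact t ht := by
    have h1 := ψ.smooth.contMDiff (hm ht)
    have h2 := φ.smooth.contMDiff ht
    have h3 := ψ.smooth.inv.contMDiff (hm ht)
    exact ((ψ.contact _ (hm ht)).mul (φ.contact t ht) (h1.mdifferentiable (by simp))
      (h2.mdifferentiable (by simp))).mul (ψ⁻¹.contact _ (hm ht))
      ((h1.comp h2).mdifferentiable (by simp)) (h3.mdifferentiable (by simp))

/-- Conjugation by the end point of an isotopy. -/
def ContactIsotopy.conjEnd (ψ φ : ContactIsotopy ξ) : ContactIsotopy ξ :=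
  ψ.conjAlong φ (fun _ => 1) contDiff_const (fun _ _ => by simp)

/-- Slide the time at which ψ is evaluated from t to 1 along t + s(1 − t). This equals 1 at t = 1
for every s, so the end point stays fixed. -/
theorem ContactIsotopy.homotopic_conjEnd (ψ φ : ContactIsotopy ξ) :
    Homotopic (ψ * φ * ψ⁻¹) (ψ.conjEnd φ) := by
  -- A homotopy is indexed by all real s, so s is clamped to [0, 1] to keep ψ within its meaningful
  -- times.
  have hproj : ∀ s : ℝ, (projIcc (0 : ℝ) 1 zero_le_one s : ℝ) ∈ Icc (0 : ℝ) 1 := fun s => Subtype.prop _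
  have hmem : ∀ s ∈ Icc (0 : ℝ) 1, ∀ t ∈ Icc (0 : ℝ) 1, t + s * (1 - t) ∈ Icc (0 : ℝ) 1 := by
    rintro s ⟨hs0, hs1⟩ t ⟨ht0, ht1⟩
    constructor <;> nlinarith
  let K : ℝ → ContactIsotopy ξ := fun s => ψ.conjAlong φ
    (fun t => t + (projIcc (0 : ℝ) 1 zero_le_one s : ℝ) * (1 - t)) (by fun_prop)
    (fun t ht => hmem _ (hproj s) t ht)
  have hK : ∀ s ∈ Icc (0 : ℝ) 1, ∀ t, (K s).at_ t
      = ψ.at_ (t + s * (1 - t)) * φ.at_ t * (ψ.at_ (t + s * (1 - t)))⁻¹ := by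
    intro s hs t
    change ψ.at_ (t + (projIcc (0 : ℝ) 1 zero_le_one s : ℝ) * (1 - t)) * φ.at_ t
      * (ψ.at_ (t + (projIcc (0 : ℝ) 1 zero_le_one s : ℝ) * (1 - t)))⁻¹ = _
    rw [projIcc_of_mem _ hs]
  refine ⟨K, ?_, fun t _ => ?_, fun t _ => ?_, fun s hs => ?_⟩
  · have h1 : IsSmoothFamily (E := E) (Icc (0 : ℝ) 1 ×ˢ Icc (0 : ℝ) 1)
        (fun p : ℝ × ℝ => ψ.at_ (p.2 + p.1 * (1 - p.2))) :=
      ψ.smooth.comp (fun p : ℝ × ℝ => p.2 + p.1 * (1 - p.2)) (by fun_prop)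
        (fun p hp => hmem _ hp.1 _ hp.2)
    have h2 := (h1.mul (smoothFamily_const φ)).mul h1.inv
    exact ⟨h2.1.congr fun p hp => congrArg (fun f : Equiv.Perm V => f p.2) (hK _ hp.1.1 p.1.2),
      h2.2.congr fun p hp => congrArg (fun f : Equiv.Perm V => f⁻¹ p.2) (hK _ hp.1.1 p.1.2)⟩
  · rw [hK 0 (by simp)]; simp [ContactIsotopy.mul_at, ContactIsotopy.inv_at]
  · rw [hK 1 (by simp)]; simp [ContactIsotopy.conjEnd, ContactIsotopy.conjAlong]
  · rw [hK s hs]; simp [ContactIsotopy.mul_at, ContactIsotopy.inv_at]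

theorem ContactIsotopy.toUniv_mul (φ ψ : ContactIsotopy ξ) :
    (φ * ψ).toUniv = φ.toUniv * ψ.toUniv := rfl

theorem ContactIsotopy.toUniv_inv (φ : ContactIsotopy ξ) : (φ⁻¹).toUniv = φ.toUniv⁻¹ := rfl

theorem ContactIsotopy.toUniv_pow (φ : ContactIsotopy ξ) (n : ℕ) :
    (φ ^ n).toUniv = φ.toUniv ^ n := rfl

theorem ContactIsotopy.toUniv_conjEnd (ψ φ : ContactIsotopy ξ) :
    (ψ.conjEnd φ).toUniv = ψ.toUniv * φ.toUniv * ψ.toUniv⁻¹ :=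
  ((Con.eq (homotopyCon ξ)).2 (ψ.homotopic_conjEnd φ)).symm

theorem exists_toUniv_eq (a : UnivCont ξ) : ∃ φ : ContactIsotopy ξ, φ.toUniv = a :=
  Quotient.exists_rep a

end Conjugation

variable [IsManifold 𝓘(ℝ, E) ∞ V] {α : ContactForm E V}

/-- The conjugating map does not depend on t, so it contributes its differential but no velocity of
its own. -/
theorem ContactIsotopy.alphaVelocity_conjEnd (ψ φ : ContactIsotopy α.contactStructure) {t : ℝ}
    (ht : t ∈ Icc (0 : ℝ) 1) (x : V) :
    (ψ.conjEnd φ).alphaVelocity α t x = ψ.alphaDeriv α 1 (φ.at_ t ((ψ.at_ 1)⁻¹ x))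
      (φ.velocity t ((ψ.at_ 1)⁻¹ x)) := by
  have h1 := (ψ.mdifferentiableAt (t := 1) (by simp) (φ.at_ t ((ψ.at_ 1)⁻¹ x))).hasMFDerivAt
  have h2 := (φ.mdifferentiableWithinAt ht ((ψ.at_ 1)⁻¹ x)).hasMFDerivWithinAt
  have h3 := (HasMFDerivAt.comp_hasMFDerivWithinAt t h1 h2).mfderivWithin
    (uniqueMDiffWithinAt_unitInterval ht)
  exact congrArg (fun w : ℝ →L[ℝ] E =>
    (α.form (ψ.at_ 1 (φ.at_ t ((ψ.at_ 1)⁻¹ x))) : E →L[ℝ] ℝ) (w 1)) h3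

/-- The contact Hamiltonian of a contact isotopy. -/
def ContactIsotopy.hamiltonian (α : ContactForm E V) (φ : ContactIsotopy α.contactStructure)
    (t : ℝ) (z : V) : ℝ :=
  φ.alphaVelocity α t ((φ.at_ t)⁻¹ z)

theorem ContactIsotopy.hamiltonian_apply (φ : ContactIsotopy α.contactStructure) (t : ℝ) (x : V) :
    φ.hamiltonian α t (φ.at_ t x) = φ.alphaVelocity α t x := by
  unfold ContactIsotopy.hamiltonian
  rw [(φ.at_ t).symm_apply_apply x |> (show (φ.at_ t)⁻¹ (φ.at_ t x) = x from ·)]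

theorem IsGeneratedBy.hamiltonian_eq {φ : ContactIsotopy α.contactStructure} {h : ℝ → V → ℝ}
    (hφ : IsGeneratedBy α φ h) {t : ℝ} (ht : t ∈ Icc (0 : ℝ) 1) (z : V) :
    φ.hamiltonian α t z = h t z := by
  have h1 := hφ t ht ((φ.at_ t)⁻¹ z)
  have h2 : φ.at_ t ((φ.at_ t)⁻¹ z) = z := (φ.at_ t).apply_symm_apply z
  exact h1.trans (congrArg (h t) h2)

theorem isNonneg_of_hamiltonian {φ : ContactIsotopy α.contactStructure}
    (h : ∀ t ∈ Icc (0 : ℝ) 1, ∀ x, 0 ≤ φ.alphaVelocity α t x) : IsNonneg α φ.toUniv :=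
  ⟨φ.hamiltonian α, φ, fun t _ x => (φ.hamiltonian_apply t x).symm, fun t ht _ => h t ht _, rfl⟩

theorem IsNonneg.exists_isotopy {a : UnivCont α.contactStructure} (h : IsNonneg α a) :
    ∃ φ : ContactIsotopy α.contactStructure, φ.toUniv = a ∧
      ∀ t ∈ Icc (0 : ℝ) 1, ∀ x, 0 ≤ φ.alphaVelocity α t x := by
  obtain ⟨h, φ, hφ, hh, rfl⟩ := h
  refine ⟨φ, rfl, fun t ht x => ?_⟩
  rw [← φ.hamiltonian_apply, hφ.hamiltonian_eq ht]
  exact hh t ht _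

/-- Positivity of the conformal factor means that signs of Hamiltonians survive composition and
conjugation; the order on the universal cover rests on this. -/
theorem ContactIsotopy.alphaDeriv_nonneg_iff (φ : ContactIsotopy α.contactStructure) {t : ℝ}
    (ht : t ∈ Icc (0 : ℝ) 1) (x : V) (v : TangentSpace 𝓘(ℝ, E) x) :
    0 ≤ φ.alphaDeriv α t x v ↔ 0 ≤ α.form x v := by
  obtain ⟨l, hl, h⟩ := φ.exists_conformalFactor ht x
  rw [h v]
  exact mul_nonneg_iff_of_pos_left hl

theorem IsNonneg.mul {a b : UnivCont α.contactStructure} (ha : IsNonneg α a) (hb : IsNonneg α b) :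
    IsNonneg α (a * b) := by
  obtain ⟨φ, rfl, hφ⟩ := ha.exists_isotopy
  obtain ⟨ψ, rfl, hψ⟩ := hb.exists_isotopy
  rw [← ContactIsotopy.toUniv_mul]
  refine isNonneg_of_hamiltonian fun t ht x => ?_
  rw [ContactIsotopy.alphaVelocity_mul _ _ ht]
  exact add_nonneg (hφ t ht _) ((φ.alphaDeriv_nonneg_iff ht _ _).2 (hψ t ht x))

theorem IsNonneg.conj {a : UnivCont α.contactStructure} (ha : IsNonneg α a)
    (b : UnivCont α.contactStructure) : IsNonneg α (b * a * b⁻¹) := by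
  obtain ⟨φ, rfl, hφ⟩ := ha.exists_isotopy
  obtain ⟨ψ, rfl⟩ := exists_toUniv_eq b
  rw [← ContactIsotopy.toUniv_conjEnd]
  refine isNonneg_of_hamiltonian fun t ht x => ?_
  rw [ContactIsotopy.alphaVelocity_conjEnd _ _ ht]
  exact (ψ.alphaDeriv_nonneg_iff (by simp) _ _).2 (hφ t ht _)

/-- Conjugation invariance gives bi-invariance: (ac)⁻¹bd = c⁻¹(a⁻¹b)c · c⁻¹d is a product of
nonnegative elements. -/
theorem Precedes.mul {a b c d : UnivCont α.contactStructure} (h : Precedes α a b)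
    (h' : Precedes α c d) : Precedes α (a * c) (b * d) := by
  have := (IsNonneg.conj h c⁻¹).mul h'
  unfold Precedes
  rwa [show c⁻¹ * (a⁻¹ * b) * (c⁻¹)⁻¹ * (c⁻¹ * d) = (a * c)⁻¹ * (b * d) by group] at this

/-- Comparison of contact Hamiltonians implies comparison in the universal cover. -/
theorem precedes_of_hamiltonian_le {φ ψ : ContactIsotopy α.contactStructure}
    (h : ∀ t ∈ Icc (0 : ℝ) 1, ∀ z, φ.hamiltonian α t z ≤ ψ.hamiltonian α t z) :
    Precedes α φ.toUniv ψ.toUniv := by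
  unfold Precedes
  rw [← ContactIsotopy.toUniv_inv, ← ContactIsotopy.toUniv_mul]
  refine isNonneg_of_hamiltonian fun t ht x => ?_
  -- In the product formula for ψ = φ(φ⁻¹ψ), the difference of the two Hamiltonians at ψ_t(x) is a
  -- positive multiple of α on the velocity of φ⁻¹ψ.
  have h1 := ContactIsotopy.alphaVelocity_mul φ (φ⁻¹ * ψ) ht x
  rw [mul_inv_cancel_left] at h1
  have h2 := h t ht (ψ.at_ t x)
  rw [ψ.hamiltonian_apply, h1] at h2
  have h3 : φ.hamiltonian α t (ψ.at_ t x) = φ.alphaVelocity α t ((φ⁻¹ * ψ).at_ t x) := rfl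
  rw [h3, le_add_iff_nonneg_right, φ.alphaDeriv_nonneg_iff ht] at h2
  exact h2

theorem Precedes.refl (a : UnivCont α.contactStructure) : Precedes α a a := by
  obtain ⟨φ, rfl⟩ := exists_toUniv_eq a
  exact precedes_of_hamiltonian_le fun _ _ _ => le_rfl

end Order

/-! ### One-forms in charts -/

section Charts

open Filter Topology

variable {E : Type*} [NormedAddCommGroup E] [NormedSpace ℝ E]
  {V : Type*} [TopologicalSpace V] [ChartedSpace E V]

/-- The derivative of the inverse of the preferred chart around `x₀`. -/
def chartDeriv (E : Type*) [NormedAddCommGroup E] [NormedSpace ℝ E]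
    {V : Type*} [TopologicalSpace V] [ChartedSpace E V] (x₀ : V) (y : E) : E →L[ℝ] E :=
  mfderiv 𝓘(ℝ, E) 𝓘(ℝ, E) (extChartAt 𝓘(ℝ, E) x₀).symm y

/-- The exterior derivative of a one-form on a vector space, as a bilinear map. -/
def dForm (A : E → E →L[ℝ] ℝ) (y : E) : E →L[ℝ] E →L[ℝ] ℝ :=
  fderiv ℝ A y - (fderiv ℝ A y).flip

theorem dForm_apply (A : E → E →L[ℝ] ℝ) (y u v : E) :
    dForm A y u v = fderiv ℝ A y u v - fderiv ℝ A y v u := rfl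

/-- The exterior derivative commutes with pull-backs. -/
theorem dForm_pullback {A B : E → E →L[ℝ] ℝ} {ψ : E → E} {y : E} (hψ : ContDiffAt ℝ 2 ψ y)
    (hB : DifferentiableAt ℝ B (ψ y)) (h : A =ᶠ[𝓝 y] fun z => (B (ψ z)).comp (fderiv ℝ ψ z))
    (u v : E) : dForm A y u v = dForm B (ψ y) (fderiv ℝ ψ y u) (fderiv ℝ ψ y v) := by
  have hψ1 : HasFDerivAt ψ (fderiv ℝ ψ y) y := (hψ.differentiableAt (by simp)).hasFDerivAt
  have hψ2 : HasFDerivAt (fderiv ℝ ψ) (fderiv ℝ (fderiv ℝ ψ) y) y :=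
    ((hψ.fderiv_right (m := 1) (by norm_num)).differentiableAt (by simp)).hasFDerivAt
  have hBψ : HasFDerivAt (fun z => B (ψ z)) ((fderiv ℝ B (ψ y)).comp (fderiv ℝ ψ y)) y :=
    hB.hasFDerivAt.comp y hψ1
  have hA : ∀ u v : E, fderiv ℝ A y u v = fderiv ℝ B (ψ y) (fderiv ℝ ψ y u) (fderiv ℝ ψ y v)
      + B (ψ y) (fderiv ℝ (fderiv ℝ ψ) y u v) := by
    intro u v
    rw [h.fderiv_eq, (hBψ.clm_comp hψ2).fderiv]
    simp [add_comm]
  -- The second derivative of ψ is symmetric, so its contribution cancels on antisymmetrization.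
  have hsymm : IsSymmSndFDerivAt ℝ ψ y := hψ.isSymmSndFDerivAt (by simp)
  rw [dForm_apply, dForm_apply, hA, hA, hsymm u v]
  ring

/-- `(z, g)` solves the equations `A z = f`, `dA(z, ·) + df = g A` of contact Hamiltonian dynamics
at `y`. -/
def SolvesAt (A : E → E →L[ℝ] ℝ) (f : E → ℝ) (y z : E) (g : ℝ) : Prop :=
  A y z = f y ∧ ∀ w, dForm A y z w + fderiv ℝ f y w = g * A y w

/-- Naturality of the contact equations under coordinate changes, with the same multiplier g; it
allows solutions found in different charts to be compared. -/
theorem SolvesAt.push {A B : E → E →L[ℝ] ℝ} {f f' : E → ℝ} {ψ : E → E} {y z : E} {g : ℝ}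
    (hs : SolvesAt A f y z g)
    (hψ : ContDiffAt ℝ 2 ψ y) (hB : DifferentiableAt ℝ B (ψ y))
    (h : A =ᶠ[𝓝 y] fun z => (B (ψ z)).comp (fderiv ℝ ψ z))
    (hf' : DifferentiableAt ℝ f' (ψ y)) (hf : f =ᶠ[𝓝 y] fun z => f' (ψ z))
    (hsurj : Function.Surjective (fderiv ℝ ψ y)) :
    SolvesAt B f' (ψ y) (fderiv ℝ ψ y z) g := by
  have hA := h.self_of_nhds
  refine ⟨?_, fun w => ?_⟩
  · have h1 := hs.1
    rw [hA, hf.self_of_nhds] at h1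
    exact h1
  · obtain ⟨w, rfl⟩ := hsurj w
    have h1 := hs.2 w
    have h2 : fderiv ℝ f y = (fderiv ℝ f' (ψ y)).comp (fderiv ℝ ψ y) := by
      rw [hf.fderiv_eq]
      exact fderiv_comp y hf' (hψ.differentiableAt (by simp))
    rw [dForm_pullback hψ hB h, h2, hA] at h1
    exact h1

/-- The linear operator `(z, g) ↦ (A z, dA(z, ·) - g A)` at `y`. -/
def contactOp (A : E → E →L[ℝ] ℝ) (y : E) : E × ℝ →L[ℝ] ℝ × (E →L[ℝ] ℝ) :=
  ((A y).comp (ContinuousLinearMap.fst ℝ E ℝ)).prod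
    ((dForm A y).comp (ContinuousLinearMap.fst ℝ E ℝ)
      - (ContinuousLinearMap.snd ℝ E ℝ).smulRight (A y))

theorem contactOp_apply (A : E → E →L[ℝ] ℝ) (y : E) (p : E × ℝ) :
    contactOp A y p = (A y p.1, dForm A y p.1 - p.2 • A y) := rfl

theorem solvesAt_iff (A : E → E →L[ℝ] ℝ) (f : E → ℝ) (y z : E) (g : ℝ) :
    SolvesAt A f y z g ↔ contactOp A y (z, g) = (f y, -fderiv ℝ f y) := by
  rw [contactOp_apply, Prod.mk.injEq]
  refine and_congr_right fun _ => ?_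
  rw [ContinuousLinearMap.ext_iff]
  refine forall_congr' fun w => ?_
  change _ ↔ dForm A y z w - g * A y w = -fderiv ℝ f y w
  constructor <;> intro h <;> linarith

theorem contDiffOn_contactOp [FiniteDimensional ℝ E] {A : E → E →L[ℝ] ℝ} {U : Set E}
    (hU : IsOpen U) (hA : ContDiffOn ℝ ∞ A U) : ContDiffOn ℝ ∞ (contactOp A) U := by
  rw [contDiffOn_clm_apply]
  intro p
  have hd : ContDiffOn ℝ ∞ (fderiv ℝ A) U := hA.fderiv_of_isOpen hU (by simp)
  refine ContDiffOn.prodMk (hA.clm_apply contDiffOn_const) ?_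
  rw [contDiffOn_clm_apply]
  intro w
  have h1 : ContDiffOn ℝ ∞ (fun y => fderiv ℝ A y p.1 w) U :=
    (hd.clm_apply contDiffOn_const).clm_apply contDiffOn_const
  have h2 : ContDiffOn ℝ ∞ (fun y => fderiv ℝ A y w p.1) U :=
    (hd.clm_apply contDiffOn_const).clm_apply contDiffOn_const
  have h3 : ContDiffOn ℝ ∞ (fun y => A y w) U := hA.clm_apply contDiffOn_const
  exact (h1.sub h2).sub (h3.const_smul p.2)

/-- For (z, g) in the kernel, A z = 0 and dA(z,·) = gA vanishes on ker A, so z = 0 by nondegeneracy;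
then gA = 0 forces g = 0. Both sides have dimension dim E + 1, so injectivity suffices. -/
theorem isInvertible_contactOp [FiniteDimensional ℝ E] {A : E → E →L[ℝ] ℝ} {y : E}
    (h0 : A y ≠ 0)
    (hA : ∀ v, A y v = 0 → (∀ w, A y w = 0 → dForm A y v w = 0) → v = 0) :
    (contactOp A y).IsInvertible := by
  have hinj : Function.Injective (contactOp A y).toLinearMap := by
    rw [← LinearMap.ker_eq_bot, LinearMap.ker_eq_bot']
    rintro ⟨z, g⟩ hz
    have h1 : A y z = 0 := congrArg Prod.fst hz
    have h2 : dForm A y z - g • A y = 0 := congrArg Prod.snd hz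
    have hz0 : z = 0 := hA z h1 fun w hw => by
      have := congrArg (fun L : E →L[ℝ] ℝ => L w) h2
      simpa [hw] using this
    subst hz0
    rw [map_zero, zero_sub, neg_eq_zero, smul_eq_zero] at h2
    rw [h2.resolve_right h0]; rfl
  have hdim : Module.finrank ℝ (E × ℝ) = Module.finrank ℝ (ℝ × (E →L[ℝ] ℝ)) := by
    have : Module.finrank ℝ (E →L[ℝ] ℝ) = Module.finrank ℝ E := by
      rw [← (LinearMap.toContinuousLinearMap (𝕜 := ℝ) (E := E) (F' := ℝ)).finrank_eq]
      exact Subspace.dual_finrank_eq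
    rw [Module.finrank_prod, Module.finrank_prod, this, add_comm]
  refine ⟨(LinearEquiv.ofInjectiveOfFinrankEq (contactOp A y).toLinearMap hinj
    hdim).toContinuousLinearEquiv, ?_⟩
  ext p <;> rfl

end Charts

/-! ### Contact vector fields -/

section ContactField

open Filter Topology

variable {E : Type*} [NormedAddCommGroup E] [NormedSpace ℝ E]
  {V : Type*} [TopologicalSpace V] [ChartedSpace E V]

local notation "e_[" x "]" => extChartAt 𝓘(ℝ, E) x

/-- The transition function between the preferred charts around two points. -/
def transition (E : Type*) [NormedAddCommGroup E] [NormedSpace ℝ E]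
    {V : Type*} [TopologicalSpace V] [ChartedSpace E V] (x₀ x₁ : V) : E → E :=
  extChartAt 𝓘(ℝ, E) x₁ ∘ (extChartAt 𝓘(ℝ, E) x₀).symm

theorem chart_symm_transition {x₀ x₁ : V} {y : E}
    (hy' : (e_[x₀]).symm y ∈ (e_[x₁]).source) :
    (e_[x₁]).symm (transition E x₀ x₁ y) = (e_[x₀]).symm y :=
  (e_[x₁]).left_inv hy'

theorem transition_mem_target {x₀ x₁ : V} {y : E}
    (hy' : (e_[x₀]).symm y ∈ (e_[x₁]).source) :
    transition E x₀ x₁ y ∈ (e_[x₁]).target :=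
  (e_[x₁]).map_source hy'

variable [IsManifold 𝓘(ℝ, E) ∞ V]

theorem contMDiffAt_chart_symm {x₀ : V} {y : E} (hy : y ∈ (e_[x₀]).target) :
    ContMDiffAt 𝓘(ℝ, E) 𝓘(ℝ, E) ∞ (e_[x₀]).symm y :=
  (contMDiffOn_extChartAt_symm x₀ y hy).contMDiffAt ((isOpen_extChartAt_target x₀).mem_nhds hy)

theorem hasMFDerivAt_chart_symm {x₀ : V} {y : E} (hy : y ∈ (e_[x₀]).target) :
    HasMFDerivAt 𝓘(ℝ, E) 𝓘(ℝ, E) (e_[x₀]).symm y (chartDeriv E x₀ y) :=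
  ((contMDiffAt_chart_symm hy).mdifferentiableAt (by simp)).hasMFDerivAt

theorem contMDiffAt_chart {x₀ x : V} (hx : x ∈ (e_[x₀]).source) :
    ContMDiffAt 𝓘(ℝ, E) 𝓘(ℝ, E) ∞ (e_[x₀]) x :=
  contMDiffAt_extChartAt' (by rwa [extChartAt_source] at hx)

theorem mfderiv_comp_chartDeriv {x₀ x : V} (hx : x ∈ (e_[x₀]).source) :
    (mfderiv 𝓘(ℝ, E) 𝓘(ℝ, E) (e_[x₀]) x : E →L[ℝ] E).comp (chartDeriv E x₀ (e_[x₀] x))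
      = ContinuousLinearMap.id ℝ E := by
  have h := mfderiv_extChartAt_comp_mfderivWithin_extChartAt_symm' (I := 𝓘(ℝ, E)) hx
  rw [modelWithCornersSelf_coe, range_id, mfderivWithin_univ] at h
  exact h

theorem chartDeriv_comp_mfderiv {x₀ x : V} (hx : x ∈ (e_[x₀]).source) :
    (chartDeriv E x₀ (e_[x₀] x)).comp (mfderiv 𝓘(ℝ, E) 𝓘(ℝ, E) (e_[x₀]) x : E →L[ℝ] E)
      = ContinuousLinearMap.id ℝ E := by
  have h := mfderivWithin_extChartAt_symm_comp_mfderiv_extChartAt' (I := 𝓘(ℝ, E)) hx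
  rw [modelWithCornersSelf_coe, range_id, mfderivWithin_univ] at h
  exact h

theorem chartDeriv_self (x : V) : chartDeriv E x (e_[x] x) = ContinuousLinearMap.id ℝ E := by
  have h := mfderivWithin_range_extChartAt_symm (I := 𝓘(ℝ, E)) (x := x)
  rw [modelWithCornersSelf_coe, range_id, mfderivWithin_univ] at h
  exact h

theorem chartDeriv_bijective {x₀ : V} {y : E} (hy : y ∈ (e_[x₀]).target) :
    Function.Bijective (chartDeriv E x₀ y) := by
  have hx := (e_[x₀]).map_target hy
  have h1 := mfderiv_comp_chartDeriv hx
  have h2 := chartDeriv_comp_mfderiv hx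
  rw [(e_[x₀]).right_inv hy] at h1 h2
  exact Function.bijective_iff_has_inverse.2 ⟨_, fun v => congrArg (fun L : E →L[ℝ] E => L v) h1,
    fun v => congrArg (fun L : E →L[ℝ] E => L v) h2⟩

theorem contDiffAt_transition {x₀ x₁ : V} {y : E} (hy : y ∈ (e_[x₀]).target)
    (hy' : (e_[x₀]).symm y ∈ (e_[x₁]).source) : ContDiffAt ℝ ∞ (transition E x₀ x₁) y :=
  ((contMDiffAt_chart hy').comp y (contMDiffAt_chart_symm hy)).contDiffAt

theorem eventually_transition {x₀ x₁ : V} {y : E} (hy : y ∈ (e_[x₀]).target)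
    (hy' : (e_[x₀]).symm y ∈ (e_[x₁]).source) :
    ∀ᶠ z in 𝓝 y, z ∈ (e_[x₀]).target ∧ (e_[x₀]).symm z ∈ (e_[x₁]).source :=
  Filter.inter_mem ((isOpen_extChartAt_target x₀).mem_nhds hy)
    ((contMDiffAt_chart_symm hy).continuousAt.preimage_mem_nhds
      ((isOpen_extChartAt_source x₁).mem_nhds hy'))

theorem chartDeriv_transition {x₀ x₁ : V} {y : E} (hy : y ∈ (e_[x₀]).target)
    (hy' : (e_[x₀]).symm y ∈ (e_[x₁]).source) :
    chartDeriv E x₀ y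
      = (chartDeriv E x₁ (transition E x₀ x₁ y)).comp (fderiv ℝ (transition E x₀ x₁) y) := by
  have h1 : HasMFDerivAt 𝓘(ℝ, E) 𝓘(ℝ, E) (transition E x₀ x₁) y
      (fderiv ℝ (transition E x₀ x₁) y) :=
    ((contDiffAt_transition hy hy').differentiableAt (by simp)).hasFDerivAt.hasMFDerivAt
  have h2 := HasMFDerivAt.comp y (hasMFDerivAt_chart_symm (transition_mem_target hy')) h1
  have h3 : (e_[x₀]).symm =ᶠ[𝓝 y] (e_[x₁]).symm ∘ transition E x₀ x₁ :=
    (eventually_transition hy hy').mono fun z hz => (chart_symm_transition hz.2).symm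
  exact (hasMFDerivAt_chart_symm hy).mfderiv.symm.trans (h2.congr_of_eventuallyEq h3).mfderiv

theorem fderiv_transition_surjective {x₀ x₁ : V} {y : E} (hy : y ∈ (e_[x₀]).target)
    (hy' : (e_[x₀]).symm y ∈ (e_[x₁]).source) :
    Function.Surjective (fderiv ℝ (transition E x₀ x₁) y) := by
  intro w
  obtain ⟨v, hv⟩ := (chartDeriv_bijective hy).2 (chartDeriv E x₁ (transition E x₀ x₁ y) w)
  refine ⟨v, (chartDeriv_bijective (transition_mem_target hy')).1 ?_⟩
  rw [← hv, chartDeriv_transition hy hy']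
  rfl

variable (α : ContactForm E V)

theorem localForm_apply (x₀ : V) (y v : E) :
    localForm α.form x₀ y v
      = (α.form ((e_[x₀]).symm y) : E →L[ℝ] ℝ) (chartDeriv E x₀ y v) := rfl

theorem localForm_self (x : V) : localForm α.form x (e_[x] x) = (α.form x : E →L[ℝ] ℝ) := by
  ext v
  rw [localForm_apply, chartDeriv_self, extChartAt_to_inv]
  rfl

theorem contDiffOn_localForm [FiniteDimensional ℝ E] (x₀ : V) :
    ContDiffOn ℝ ∞ (localForm α.form x₀) (e_[x₀]).target := by
  rw [contDiffOn_clm_apply]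
  intro v
  have hT := (contMDiffOn_extChartAt_symm (I := 𝓘(ℝ, E)) (n := ∞) x₀).contMDiffOn_tangentMapWithin
    (m := ∞) (by simp) (isOpen_extChartAt_target x₀).uniqueMDiffOn
  have hv : ContMDiff 𝓘(ℝ, E) 𝓘(ℝ, E).tangent ∞
      (fun y : E => (⟨y, v⟩ : TangentBundle 𝓘(ℝ, E) E)) := fun y =>
    (contMDiffAt_vectorSpace_iff_contDiffAt (V := fun _ : E => v)).2 contDiffAt_const
  have h := α.contMDiff_apply.comp_contMDiffOn (hT.comp hv.contMDiffOn (fun y hy => hy))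
  refine (contMDiffOn_iff_contDiffOn.1 h).congr fun y hy => ?_
  change (α.form ((e_[x₀]).symm y) : E →L[ℝ] ℝ) (chartDeriv E x₀ y v)
    = (α.form ((e_[x₀]).symm y) : E →L[ℝ] ℝ)
      (mfderivWithin 𝓘(ℝ, E) 𝓘(ℝ, E) (e_[x₀]).symm (e_[x₀]).target y v)
  rw [mfderivWithin_of_isOpen (isOpen_extChartAt_target x₀) hy]
  rfl

theorem localForm_transition {x₀ x₁ : V} {y : E} (hy : y ∈ (e_[x₀]).target)
    (hy' : (e_[x₀]).symm y ∈ (e_[x₁]).source) :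
    localForm α.form x₀ =ᶠ[𝓝 y] fun z =>
      (localForm α.form x₁ (transition E x₀ x₁ z)).comp (fderiv ℝ (transition E x₀ x₁) z) := by
  filter_upwards [eventually_transition hy hy'] with z hz
  ext v
  rw [localForm_apply, ContinuousLinearMap.comp_apply, localForm_apply,
    chart_symm_transition hz.2, chartDeriv_transition hz.1 hz.2]
  rfl

theorem isInvertible_contactOp_self [FiniteDimensional ℝ E] (x : V) :
    (contactOp (localForm α.form x) (e_[x] x)).IsInvertible := by
  refine isInvertible_contactOp ?_ ?_
  · rw [localForm_self]; exact α.ne_zero x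
  · rw [localForm_self]
    exact α.nondegenerate x

/-- On a neighbourhood of every point, read in the preferred chart, there is a smooth solution of
the equations defining the contact vector field of `f`. -/
theorem exists_local_solution [FiniteDimensional ℝ E] {f : V → ℝ}
    (hf : ContMDiff 𝓘(ℝ, E) 𝓘(ℝ, ℝ) ∞ f) (x₀ : V) :
    ∃ (U : Set E) (S : E → E) (G : E → ℝ), IsOpen U ∧ e_[x₀] x₀ ∈ U ∧ U ⊆ (e_[x₀]).target ∧
      ContDiffOn ℝ ∞ S U ∧ ContDiffOn ℝ ∞ G U ∧
      ∀ y ∈ U, SolvesAt (localForm α.form x₀) (f ∘ (e_[x₀]).symm) y (S y) (G y) := by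
  set A := localForm α.form x₀ with hA
  set T := (e_[x₀]).target with hT
  have hTo : IsOpen T := isOpen_extChartAt_target x₀
  have hop : ContDiffOn ℝ ∞ (contactOp A) T := contDiffOn_contactOp hTo (contDiffOn_localForm α x₀)
  have hF : ContDiffOn ℝ ∞ (f ∘ (e_[x₀]).symm) T :=
    contMDiffOn_iff_contDiffOn.1 (hf.comp_contMDiffOn (contMDiffOn_extChartAt_symm x₀))
  -- Nondegeneracy is given in the chart centred at each point, so invertibility is known here only
  -- at the centre; it is an open condition and persists on U.
  set U := T ∩ contactOp A ⁻¹' range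
    (fun L : (E × ℝ) ≃L[ℝ] (ℝ × (E →L[ℝ] ℝ)) => (L : E × ℝ →L[ℝ] ℝ × (E →L[ℝ] ℝ))) with hU
  have hUo : IsOpen U := hop.continuousOn.isOpen_inter_preimage hTo ContinuousLinearEquiv.isOpen
  have hdF : ContDiffOn ℝ ∞ (fderiv ℝ (f ∘ (e_[x₀]).symm)) T := hF.fderiv_of_isOpen hTo (by simp)
  let P : E → E × ℝ := fun y => (contactOp A y).inverse
    ((f ∘ (e_[x₀]).symm) y, -fderiv ℝ (f ∘ (e_[x₀]).symm) y)
  have hP : ContDiffOn ℝ ∞ P U := by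
    refine ContDiffOn.clm_apply ?_ ((hF.prodMk hdF.neg).mono inter_subset_left)
    intro y hy
    obtain ⟨L, hL⟩ := hy.2
    have h1 : ContDiffAt ℝ ∞ ContinuousLinearMap.inverse (contactOp A y) := by
      rw [← hL]; exact contDiffAt_map_inverse (𝕜 := ℝ) L
    exact h1.comp_contDiffWithinAt y ((hop y hy.1).mono inter_subset_left)
  refine ⟨U, fun y => (P y).1, fun y => (P y).2, hUo,
    ⟨mem_extChartAt_target x₀, isInvertible_contactOp_self α x₀⟩, inter_subset_left,
    contDiff_fst.comp_contDiffOn hP, contDiff_snd.comp_contDiffOn hP, fun y hy => ?_⟩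
  rw [solvesAt_iff]
  obtain ⟨L, hL⟩ := hy.2
  change contactOp A y ((contactOp A y).inverse _) = _
  rw [← hL, ContinuousLinearMap.inverse_equiv]
  exact L.apply_symm_apply _

/-- The contact vector field with a given contact Hamiltonian, together with its local
descriptions. -/
theorem exists_contactField [FiniteDimensional ℝ E] {f : V → ℝ}
    (hf : ContMDiff 𝓘(ℝ, E) 𝓘(ℝ, ℝ) ∞ f) :
    ∃ Z : ∀ x : V, TangentSpace 𝓘(ℝ, E) x,
      (∀ x, α.form x (Z x) = f x) ∧
      ∀ x₀ : V, ∃ (U : Set E) (S : E → E) (G : E → ℝ), IsOpen U ∧ e_[x₀] x₀ ∈ U ∧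
        U ⊆ (e_[x₀]).target ∧ ContDiffOn ℝ ∞ S U ∧ ContDiffOn ℝ ∞ G U ∧
        (∀ y ∈ U, SolvesAt (localForm α.form x₀) (f ∘ (e_[x₀]).symm) y (S y) (G y)) ∧
        ∀ y ∈ U, chartDeriv E x₀ y (S y) = (Z ((e_[x₀]).symm y) : E) := by
  choose U S G hUo hmem hUT hS hG hsol using exists_local_solution α hf
  -- Z at x is the solution at the centre of the chart of x itself, where tangent vectors need no
  -- transport.
  refine ⟨fun x => S x (e_[x] x), fun x => ?_, fun x₀ => ⟨U x₀, S x₀, G x₀, hUo x₀, hmem x₀, hUT x₀,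
    hS x₀, hG x₀, hsol x₀, fun y hy => ?_⟩⟩
  · have h := (hsol x _ (hmem x)).1
    rw [localForm_self, Function.comp_apply, extChartAt_to_inv] at h
    exact h
  · set x := (e_[x₀]).symm y with hx
    have hyT := hUT x₀ hy
    have hy' : (e_[x₀]).symm y ∈ (e_[x]).source := mem_extChartAt_source x
    have htr : transition E x₀ x y = e_[x] x := rfl
    have hfx : ContDiffAt ℝ ∞ (f ∘ (e_[x]).symm) (transition E x₀ x y) :=
      (hf.contMDiffAt.comp _ (contMDiffAt_chart_symm (transition_mem_target hy'))).contDiffAt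
    have hAx : ContDiffAt ℝ ∞ (localForm α.form x) (transition E x₀ x y) :=
      (contDiffOn_localForm α x).contDiffAt
        ((isOpen_extChartAt_target x).mem_nhds (transition_mem_target hy'))
    have h1 := (hsol x₀ y hy).push ((contDiffAt_transition hyT hy').of_le (by norm_cast))
      (hAx.differentiableAt (by simp)) (localForm_transition α hyT hy')
      (hfx.differentiableAt (by simp))
      ((eventually_transition hyT hy').mono fun z hz =>
        (congrArg f (chart_symm_transition hz.2)).symm)
      (fderiv_transition_surjective hyT hy')
    have h2 := hsol x _ (hmem x)
    rw [htr] at h1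
    rw [solvesAt_iff] at h1 h2
    -- The solution pushed from the chart of x₀ and the one at the centre of the chart of x solve
    -- the same invertible system, hence agree.
    obtain ⟨L, hL⟩ := isInvertible_contactOp_self α x
    rw [← hL] at h1 h2
    have h3 := congrArg Prod.fst (L.injective (h1.trans h2.symm))
    rw [chartDeriv_transition hyT hy', ContinuousLinearMap.comp_apply, htr, chartDeriv_self]
    exact h3

end ContactField

/-! ### Local contact flows -/

section LocalFlow

open Filter Topology

universe u

variable {E : Type u} [NormedAddCommGroup E] [NormedSpace ℝ E]

/-- The derivative of a flow satisfies the linearized equation. -/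
theorem hasDerivAt_fderiv_flow {S : E → E} {ψ : ℝ × E → E} {s : ℝ} {y : E}
    (hψ : ContDiffAt ℝ 2 ψ (s, y)) (hS : DifferentiableAt ℝ S (ψ (s, y)))
    (hflow : ∀ᶠ q in 𝓝 (s, y), HasDerivAt (fun s => ψ (s, q.2)) (S (ψ q)) q.1 ∧
      ContDiffAt ℝ 2 ψ q) (v : E) :
    HasDerivAt (fun s => fderiv ℝ ψ (s, y) (0, v))
      (fderiv ℝ S (ψ (s, y)) (fderiv ℝ ψ (s, y) (0, v))) s := by
  have h5 : HasFDerivAt (fderiv ℝ ψ) (fderiv ℝ (fderiv ℝ ψ) (s, y)) (s, y) :=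
    ((hψ.fderiv_right (m := 1) (by norm_num)).differentiableAt (by simp)).hasFDerivAt
  have happly : ∀ u : ℝ × E, HasFDerivAt (fun q => fderiv ℝ ψ q u)
      ((fderiv ℝ (fderiv ℝ ψ) (s, y)).flip u) (s, y) := fun u =>
    (ContinuousLinearMap.apply ℝ E u).hasFDerivAt.comp (s, y) h5
  have hcurve : ∀ q : ℝ × E, HasDerivAt (fun s : ℝ => (s, q.2)) ((1 : ℝ), (0 : E)) q.1 := fun q =>
    (hasDerivAt_id _).prodMk (hasDerivAt_const _ _)
  have h7 : HasDerivAt (fun s => fderiv ℝ ψ (s, y) (0, v))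
      (fderiv ℝ (fderiv ℝ ψ) (s, y) (1, 0) (0, v)) s :=
    HasFDerivAt.comp_hasDerivAt (l := fun q => fderiv ℝ ψ q (0, v)) (f := fun s => (s, y))
      (l' := (fderiv ℝ (fderiv ℝ ψ) (s, y)).flip (0, v)) s (happly (0, v)) (hcurve (s, y))
  -- The time derivative of ψ is S ∘ ψ near the point; differentiating in y and exchanging the mixed
  -- derivatives gives the linearized equation.
  have h8 : (fun q => fderiv ℝ ψ q (1, 0)) =ᶠ[𝓝 (s, y)] fun q => S (ψ q) := by
    refine hflow.mono fun q hq => ?_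
    have h4 : HasFDerivAt ψ (fderiv ℝ ψ q) (q.1, q.2) :=
      (hq.2.differentiableAt (by simp)).hasFDerivAt
    exact (h4.comp_hasDerivAt q.1 (hcurve q)).unique hq.1
  have h9 : HasFDerivAt (fun q => S (ψ q))
      ((fderiv ℝ S (ψ (s, y))).comp (fderiv ℝ ψ (s, y))) (s, y) :=
    hS.hasFDerivAt.comp _ (hψ.differentiableAt (by simp)).hasFDerivAt
  have h11 : fderiv ℝ (fderiv ℝ ψ) (s, y) (0, v) (1, 0)
      = fderiv ℝ S (ψ (s, y)) (fderiv ℝ ψ (s, y) (0, v)) :=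
    congrArg (fun L : ℝ × E →L[ℝ] E => L (0, v))
      ((happly (1, 0)).unique (h9.congr_of_eventuallyEq h8))
  have hsymm : IsSymmSndFDerivAt ℝ ψ (s, y) := hψ.isSymmSndFDerivAt (by simp)
  rw [← h11, ← hsymm (1, 0) (0, v)]
  exact h7

/-- Along a solution of the contact equations, the form evaluated on a solution of the linearized
equation satisfies a scalar linear equation. -/
theorem SolvesAt.hasDerivAt {A : E → E →L[ℝ] ℝ} {f : E → ℝ} {S : E → E} {G : E → ℝ} {c w : ℝ → E}
    {s : ℝ} (hA : DifferentiableAt ℝ A (c s)) (hS : DifferentiableAt ℝ S (c s))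
    (hsol : ∀ᶠ y in 𝓝 (c s), SolvesAt A f y (S y) (G y)) (hc : HasDerivAt c (S (c s)) s)
    (hw : HasDerivAt w (fderiv ℝ S (c s) (w s)) s) :
    HasDerivAt (fun r => A (c r) (w r)) (G (c s) * A (c s) (w s)) s := by
  have h5 : HasDerivAt (fun r => A (c r) (w r))
      (fderiv ℝ A (c s) (S (c s)) (w s) + A (c s) (fderiv ℝ S (c s) (w s))) s :=
    HasDerivAt.clm_apply (HasFDerivAt.comp_hasDerivAt s hA.hasFDerivAt hc) hw
  have h6 := hsol.self_of_nhds.2 (w s)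
  -- Substituting f = A(S) turns dA(S, w) + df(w) into DA(S)w + A(DS·w), which is the derivative of
  -- A(w) along the curve.
  have h7 : f =ᶠ[𝓝 (c s)] fun z => A z (S z) := hsol.mono fun z hz => hz.1.symm
  have h8 : fderiv ℝ f (c s) (w s)
      = A (c s) (fderiv ℝ S (c s) (w s)) + fderiv ℝ A (c s) (w s) (S (c s)) := by
    rw [h7.fderiv_eq, (hA.hasFDerivAt.clm_apply hS.hasFDerivAt).fderiv]
    rfl
  rw [h8, dForm_apply] at h6
  refine h5.congr_deriv ?_
  rw [← h6]
  ring

/-- The local flow of a solution of the contact equations preserves the kernel of the form. -/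
theorem eventually_flow_preserves {U : Set E} (hU : IsOpen U) {y₀ : E} (hy₀ : y₀ ∈ U)
    {A : E → E →L[ℝ] ℝ} {f : E → ℝ} {S : E → E} {G : E → ℝ} (hA : ContDiffOn ℝ ∞ A U)
    (hS : ContDiffOn ℝ ∞ S U) (hG : ContDiffOn ℝ ∞ G U)
    (hsol : ∀ y ∈ U, SolvesAt A f y (S y) (G y)) {ψ : ℝ × E → E} (hψ : ContDiffAt ℝ ∞ ψ (0, y₀))
    (hψ0 : ψ (0, y₀) = y₀) (hflow : ∀ᶠ p : ℝ × E in 𝓝 (0, y₀),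
      ψ (0, p.2) = p.2 ∧ ψ p ∈ U ∧ HasDerivAt (fun s => ψ (s, p.2)) (S (ψ p)) p.1) :
    ∀ᶠ p : ℝ × E in 𝓝 (0, y₀), ∀ v, A p.2 v = 0 → A (ψ p) (fderiv ℝ ψ p (0, v)) = 0 := by
  set K := |G y₀| + 1 with hK
  have hGc : ContinuousAt G y₀ := (hG.continuousOn).continuousAt (hU.mem_nhds hy₀)
  have hψc : Tendsto ψ (𝓝 (0, y₀)) (𝓝 y₀) := by
    have := hψ.continuousAt
    rwa [ContinuousAt, hψ0] at this
  have hGK : ∀ᶠ p in 𝓝 ((0 : ℝ), y₀), |G (ψ p)| < K :=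
    hψc.eventually ((continuous_abs.continuousAt.comp hGc).eventually (gt_mem_nhds (by
      simp [hK])))
  have hψ2 : ∀ᶠ p in 𝓝 ((0 : ℝ), y₀), ContDiffAt ℝ 2 ψ p :=
    (hψ.of_le (m := 2) (by norm_cast)).eventually (by simp)
  obtain ⟨ε, hε, hbox⟩ := Metric.eventually_nhds_iff.1
    ((hflow.and (hGK.and hψ2)).and (eventually_eventually_nhds.2 (hflow.and hψ2)))
  rw [Metric.eventually_nhds_iff]
  refine ⟨ε, hε, ?_⟩
  rintro ⟨t, y⟩ hp v hv
  rw [Prod.dist_eq, max_lt_iff] at hp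
  obtain ⟨ht, hy⟩ := hp
  rw [Real.dist_eq, sub_zero] at ht
  change |t| < ε at ht
  change A y v = 0 at hv
  have hb := fun s (hs : s ∈ Ioo (-ε) ε) => hbox (y := ((s, y) : ℝ × E))
    (by rw [Prod.dist_eq]; exact max_lt (by simpa [abs_lt] using hs) hy)
  set w : ℝ → E := fun s => fderiv ℝ ψ (s, y) (0, v) with hw
  set a : ℝ → ℝ := fun s => A (ψ (s, y)) (w s) with ha
  have ha' : ∀ s ∈ Ioo (-ε) ε, HasDerivAt a (G (ψ (s, y)) * a s) s := by
    intro s hs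
    obtain ⟨⟨h1, h2, h3⟩, h4⟩ := hb s hs
    have hAd := (hA.contDiffAt (hU.mem_nhds h1.2.1)).differentiableAt (by simp)
    have hSd := (hS.contDiffAt (hU.mem_nhds h1.2.1)).differentiableAt (by simp)
    exact SolvesAt.hasDerivAt (c := fun s => ψ (s, y)) hAd hSd
      (Filter.mem_of_superset (hU.mem_nhds h1.2.1) hsol) h1.2.2
      (hasDerivAt_fderiv_flow h3 hSd (h4.mono fun q hq => ⟨hq.1.2.2, hq.2⟩) v)
  have h0mem : (0 : ℝ) ∈ Ioo (-ε) ε := ⟨by linarith, hε⟩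
  have ha0 : a 0 = 0 := by
    obtain ⟨⟨h1, h2, h3⟩, h4⟩ := hb 0 h0mem
    have h5 : HasFDerivAt (fun z : E => ψ (0, z))
        ((fderiv ℝ ψ (0, y)).comp (ContinuousLinearMap.inr ℝ ℝ E)) y :=
      HasFDerivAt.comp y (h3.differentiableAt (by simp)).hasFDerivAt (hasFDerivAt_prodMk_right 0 y)
    have h6 : (fun z : E => ψ (0, z)) =ᶠ[𝓝 y] id := by
      have : Tendsto (fun z : E => ((0 : ℝ), z)) (𝓝 y) (𝓝 (0, y)) := by
        exact (Continuous.prodMk_right (0 : ℝ)).tendsto y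
      exact (this.eventually h4).mono fun z hz => hz.1.1
    have h7 := h5.unique ((hasFDerivAt_id y).congr_of_eventuallyEq h6)
    have h8 : w 0 = v := congrArg (fun L : E →L[ℝ] E => L v) h7
    change A (ψ (0, y)) (w 0) = 0
    rw [h8, h1.1, hv]
  -- The function a solves a' = G·a with a(0) = 0; the bound K on |G| along the flow is the
  -- Lipschitz constant for uniqueness.
  have huniq : EqOn a (fun _ => 0) (Ioo (-ε) ε) := by
    refine ODE_solution_unique_of_mem_Ioo (v := fun s x => G (ψ (s, y)) * x) (s := fun _ => univ)
      (K := ⟨K, by positivity⟩) (fun s hs => ?_) h0mem (fun s hs => ⟨ha' s hs, mem_univ _⟩)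
      (fun s hs => ⟨by simpa using hasDerivAt_const s (0 : ℝ), mem_univ _⟩) ha0
    refine LipschitzWith.lipschitzOnWith (LipschitzWith.of_dist_le_mul fun x x' => ?_)
    rw [Real.dist_eq, Real.dist_eq, ← mul_sub, abs_mul]
    exact mul_le_mul_of_nonneg_right (hb s hs).1.2.1.le (abs_nonneg _)
  exact huniq (abs_lt.1 ht)

variable [FiniteDimensional ℝ E]

/-- A vector field which is smooth near a point agrees near this point with a smooth one. -/
theorem exists_contDiff_eventuallyEq {U : Set E} (hU : IsOpen U) {y₀ : E} (hy₀ : y₀ ∈ U)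
    {S : E → E} (hS : ContDiffOn ℝ ∞ S U) : ∃ Z : E → E, ContDiff ℝ ∞ Z ∧ Z =ᶠ[𝓝 y₀] S := by
  obtain ⟨r, hr, hrU⟩ := Metric.nhds_basis_closedBall.mem_iff.1 (hU.mem_nhds hy₀)
  let χ : ContDiffBump y₀ := ⟨r / 2, r, by positivity, by linarith⟩
  refine ⟨fun y => χ y • S y, contDiff_iff_contDiffAt.2 fun y => ?_, ?_⟩
  · by_cases hy : y ∈ tsupport χ
    · rw [χ.tsupport_eq] at hy
      exact χ.contDiff.contDiffAt.smul (hS.contDiffAt (hU.mem_nhds (hrU hy)))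
    · refine (contDiffAt_const (c := (0 : E))).congr_of_eventuallyEq ?_
      filter_upwards [notMem_tsupport_iff_eventuallyEq.1 hy] with z hz
      rw [hz]; simp
  · filter_upwards [χ.eventuallyEq_one] with z hz
    rw [hz]; simp

/-- Replace S by a globally smooth field agreeing with it near y₀; by continuity its flow stays in
the region of agreement for small times. -/
theorem exists_contDiffAt_flow_of_contDiffOn {U : Set E} (hU : IsOpen U) {y₀ : E} (hy₀ : y₀ ∈ U)
    {S : E → E} (hS : ContDiffOn ℝ ∞ S U) :
    ∃ ψ : ℝ × E → E, ContDiffAt ℝ ∞ ψ (0, y₀) ∧ ψ (0, y₀) = y₀ ∧ ∀ᶠ p : ℝ × E in 𝓝 (0, y₀),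
      ψ (0, p.2) = p.2 ∧ ψ p ∈ U ∧ HasDerivAt (fun s => ψ (s, p.2)) (S (ψ p)) p.1 := by
  obtain ⟨Z, hZ, hZS⟩ := exists_contDiff_eventuallyEq hU hy₀ hS
  obtain ⟨ψ, hψ, hψZ⟩ := exists_contDiffAt_flow Z hZ y₀
  have h0 : ψ (0, y₀) = y₀ := hψZ.self_of_nhds.1
  have hc : Tendsto ψ (𝓝 (0, y₀)) (𝓝 y₀) := by
    have := hψ.continuousAt
    rwa [ContinuousAt, h0] at this
  refine ⟨ψ, hψ, h0, ?_⟩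
  filter_upwards [hψZ, hc.eventually hZS, hc.eventually (hU.mem_nhds hy₀)] with p hp h1 h2
  exact ⟨hp.1, h2, h1 ▸ hp.2⟩

end LocalFlow

/-! ### Flows on compact manifolds -/

section GlobalFlow

open Filter Topology

universe u

variable {E : Type u} [NormedAddCommGroup E] [NormedSpace ℝ E]
  {V : Type*} [TopologicalSpace V] [ChartedSpace E V] [IsManifold 𝓘(ℝ, E) ∞ V]

local notation "e_[" x "]" => extChartAt 𝓘(ℝ, E) x

theorem contMDiffAt_of_chart {Z : ∀ x : V, TangentSpace 𝓘(ℝ, E) x} {x₀ : V} {U : Set E} {S : E → E}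
    (hU : IsOpen U) (hx₀ : e_[x₀] x₀ ∈ U) (hUT : U ⊆ (e_[x₀]).target) (hS : ContDiffOn ℝ ∞ S U)
    (hZ : ∀ y ∈ U, chartDeriv E x₀ y (S y) = (Z ((e_[x₀]).symm y) : E)) :
    ContMDiffAt 𝓘(ℝ, E) 𝓘(ℝ, E).tangent ∞ (fun x => (⟨x, Z x⟩ : TangentBundle 𝓘(ℝ, E) V)) x₀ := by
  have hT := (contMDiffOn_extChartAt_symm (I := 𝓘(ℝ, E)) (n := ∞) x₀).contMDiffOn_tangentMapWithin
    (m := ∞) (by simp) (isOpen_extChartAt_target x₀).uniqueMDiffOn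
  have hSm : ContMDiffAt 𝓘(ℝ, E) 𝓘(ℝ, E).tangent ∞
      (fun y : E => (⟨y, S y⟩ : TangentBundle 𝓘(ℝ, E) E)) (e_[x₀] x₀) :=
    (contMDiffAt_vectorSpace_iff_contDiffAt (V := S)).2 (hS.contDiffAt (hU.mem_nhds hx₀))
  have hTU : ContMDiffAt 𝓘(ℝ, E) 𝓘(ℝ, E).tangent ∞
      (fun y : E => tangentMapWithin 𝓘(ℝ, E) 𝓘(ℝ, E) (e_[x₀]).symm (e_[x₀]).target
        (⟨y, S y⟩ : TangentBundle 𝓘(ℝ, E) E)) (e_[x₀] x₀) := by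
    rw [← contMDiffWithinAt_univ] at hSm ⊢
    have h1 := ContMDiffWithinAt.comp (s := (e_[x₀]).target)
      (f := fun y : E => (⟨y, S y⟩ : TangentBundle 𝓘(ℝ, E) E)) (e_[x₀] x₀)
      (hT ⟨e_[x₀] x₀, S (e_[x₀] x₀)⟩ (hUT hx₀)) (hSm.mono (subset_univ _)) (fun y hy => hy)
    exact (h1.contMDiffAt ((isOpen_extChartAt_target x₀).mem_nhds (hUT hx₀))).contMDiffWithinAt
  refine (hTU.comp x₀ (contMDiffAt_chart (mem_extChartAt_source x₀))).congr_of_eventuallyEq ?_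
  have h1 : ∀ᶠ x in 𝓝 x₀, x ∈ (e_[x₀]).source := extChartAt_source_mem_nhds x₀
  have h2 : ∀ᶠ x in 𝓝 x₀, e_[x₀] x ∈ U := (continuousAt_extChartAt x₀).eventually
    (hU.mem_nhds hx₀)
  filter_upwards [h1, h2] with x hx hxU
  have h3 := hZ _ hxU
  have h4 : (e_[x₀]).symm (e_[x₀] x) = x := (e_[x₀]).left_inv hx
  have h5 : chartDeriv E x₀ (e_[x₀] x) = mfderivWithin 𝓘(ℝ, E) 𝓘(ℝ, E) (e_[x₀]).symm
      (e_[x₀]).target (e_[x₀] x) :=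
    (mfderivWithin_of_isOpen (isOpen_extChartAt_target x₀) (hUT hxU)).symm
  have h6 : ∀ (x' : V) (w : E), x' = x → w = (Z x' : E) →
      (⟨x, Z x⟩ : TangentBundle 𝓘(ℝ, E) V) = ⟨x', w⟩ := by
    rintro x' w rfl rfl; rfl
  refine h6 _ _ h4 ?_
  rw [← h3, h5]
  rfl

theorem flow_add [T2Space V] {Z : ∀ x : V, TangentSpace 𝓘(ℝ, E) x}
    (hZ : ContMDiff 𝓘(ℝ, E) 𝓘(ℝ, E).tangent 1
      (fun x => (⟨x, Z x⟩ : TangentBundle 𝓘(ℝ, E) V)))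
    {θ : ℝ → V → V} (h0 : ∀ x, θ 0 x = x) (hθ : ∀ x, IsMIntegralCurve (fun t => θ t x) Z)
    (s t : ℝ) (x : V) : θ (s + t) x = θ s (θ t x) := by
  have : IsManifold 𝓘(ℝ, E) 1 V := IsManifold.of_le (n := ∞) (by norm_cast)
  have h := isMIntegralCurve_Ioo_eq_of_contMDiff_boundaryless (t₀ := 0) hZ
    ((hθ x).comp_add t) (hθ (θ t x)) (by simp [h0])
  exact congrFun h s

variable [FiniteDimensional ℝ E] (α : ContactForm E V)

/-- The local flow of a contact vector field. -/
theorem exists_local_contact_flow {Z : ∀ x : V, TangentSpace 𝓘(ℝ, E) x} {f : E → ℝ}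
    {x₀ : V} {U : Set E} {S : E → E} {G : E → ℝ}
    (hU : IsOpen U) (hx₀ : e_[x₀] x₀ ∈ U) (hUT : U ⊆ (e_[x₀]).target) (hS : ContDiffOn ℝ ∞ S U)
    (hG : ContDiffOn ℝ ∞ G U)
    (hsol : ∀ y ∈ U, SolvesAt (localForm α.form x₀) f y (S y) (G y))
    (hZ : ∀ y ∈ U, chartDeriv E x₀ y (S y) = (Z ((e_[x₀]).symm y) : E)) :
    ∃ Φ : ℝ × V → V, ContMDiffAt (𝓘(ℝ, ℝ).prod 𝓘(ℝ, E)) 𝓘(ℝ, E) ∞ Φ (0, x₀) ∧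
      (∃ ε > 0, ∀ᶠ x in 𝓝 x₀, Φ (0, x) = x ∧
        IsMIntegralCurveOn (fun t => Φ (t, x)) Z (Ioo (-ε) ε)) ∧
      ∀ᶠ p in 𝓝 ((0 : ℝ), x₀), ∀ v, α.form p.2 v = 0 →
        α.form (Φ p) (mfderiv 𝓘(ℝ, E) 𝓘(ℝ, E) (fun x => Φ (p.1, x)) p.2 v) = 0 := by
  obtain ⟨ψ, hψ, hψ0, hflow⟩ := exists_contDiffAt_flow_of_contDiffOn hU hx₀ hS
  have hpres := eventually_flow_preserves hU hx₀ ((contDiffOn_localForm α x₀).mono hUT) hS hG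
    hsol hψ hψ0 hflow
  have hψd : ∀ᶠ p in 𝓝 ((0 : ℝ), e_[x₀] x₀), DifferentiableAt ℝ ψ p :=
    ((hψ.of_le (m := 1) (by norm_cast)).eventually (by simp)).mono fun p hp =>
      hp.differentiableAt (by simp)
  have hce : ContMDiffAt (𝓘(ℝ, ℝ).prod 𝓘(ℝ, E)) (𝓘(ℝ, ℝ).prod 𝓘(ℝ, E)) ∞
      (fun p : ℝ × V => (p.1, e_[x₀] p.2)) (0, x₀) :=
    contMDiffAt_fst.prodMk ((contMDiffAt_chart (mem_extChartAt_source x₀)).comp (0, x₀)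
      contMDiffAt_snd)
  have hψm : ContMDiffAt (𝓘(ℝ, ℝ).prod 𝓘(ℝ, E)) 𝓘(ℝ, E) ∞ ψ (0, e_[x₀] x₀) := by
    have h := hψ.contMDiffAt
    rw [modelWithCornersSelf_prod, ← chartedSpaceSelf_prod] at h
    exact h
  let Φ : ℝ × V → V := fun p => (e_[x₀]).symm (ψ (p.1, e_[x₀] p.2))
  have htend : Tendsto (fun p : ℝ × V => (p.1, e_[x₀] p.2)) (𝓝 (0, x₀)) (𝓝 (0, e_[x₀] x₀)) :=
    hce.continuousAt
  have hsrc : ∀ᶠ x in 𝓝 x₀, x ∈ (e_[x₀]).source := extChartAt_source_mem_nhds x₀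
  have hsrc' : ∀ᶠ p in 𝓝 ((0 : ℝ), x₀), p.2 ∈ (e_[x₀]).source :=
    (continuous_snd.tendsto ((0 : ℝ), x₀)).eventually hsrc
  refine ⟨Φ, ?_, ?_, ?_⟩
  · refine ContMDiffAt.comp (I' := 𝓘(ℝ, E)) (0, x₀) (g := (e_[x₀]).symm) ?_
      (ContMDiffAt.comp (0, x₀) hψm hce)
    change ContMDiffAt 𝓘(ℝ, E) 𝓘(ℝ, E) ∞ (e_[x₀]).symm (ψ (0, e_[x₀] x₀))
    rw [hψ0]
    exact contMDiffAt_chart_symm (hUT hx₀)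
  · obtain ⟨ε, hε, hbox⟩ := Metric.eventually_nhds_iff.1 hflow
    have hnear : ∀ᶠ x in 𝓝 x₀, dist (e_[x₀] x) (e_[x₀] x₀) < ε :=
      (continuousAt_extChartAt x₀).eventually (Metric.ball_mem_nhds _ hε)
    refine ⟨ε, hε, ?_⟩
    filter_upwards [hsrc, hnear] with x hx hxε
    have hb := fun t (ht : t ∈ Ioo (-ε) ε) => hbox (y := ((t, e_[x₀] x) : ℝ × E))
      (by rw [Prod.dist_eq]; exact max_lt (by simpa [abs_lt] using ht) hxε)
    refine ⟨?_, fun t ht => ?_⟩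
    · change (e_[x₀]).symm (ψ (0, e_[x₀] x)) = x
      rw [(hb 0 ⟨by linarith, hε⟩).1]
      exact (e_[x₀]).left_inv hx
    · obtain ⟨-, h1, h2⟩ := hb t ht
      have h3 : HasMFDerivAt 𝓘(ℝ, ℝ) 𝓘(ℝ, E) (fun s => ψ (s, e_[x₀] x)) t
          ((1 : ℝ →L[ℝ] ℝ).smulRight (S (ψ (t, e_[x₀] x)))) := h2.hasFDerivAt.hasMFDerivAt
      have h4 := HasMFDerivAt.comp t (hasMFDerivAt_chart_symm (hUT h1)) h3
      refine (h4.congr_mfderiv ?_).hasMFDerivWithinAt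
      refine ContinuousLinearMap.ext fun r => ?_
      change chartDeriv E x₀ (ψ (t, e_[x₀] x)) ((show ℝ from r) • S (ψ (t, e_[x₀] x)))
        = (show ℝ from r) • (Z ((e_[x₀]).symm (ψ (t, e_[x₀] x))) : E)
      rw [map_smul, hZ _ h1]
      rfl
  · filter_upwards [htend.eventually hpres, htend.eventually hflow, htend.eventually hψd, hsrc']
      with p h1 h2 h3 hx v hv
    obtain ⟨t, x⟩ := p
    have hx' : x ∈ (e_[x₀]).source := hx
    have hd1 : HasMFDerivAt 𝓘(ℝ, E) 𝓘(ℝ, E) (e_[x₀]) x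
        (mfderiv 𝓘(ℝ, E) 𝓘(ℝ, E) (e_[x₀]) x) :=
      ((contMDiffAt_chart hx').mdifferentiableAt (by simp)).hasMFDerivAt
    have hd2 : HasFDerivAt (fun y => ψ (t, y))
        ((fderiv ℝ ψ (t, e_[x₀] x)).comp (ContinuousLinearMap.inr ℝ ℝ E)) (e_[x₀] x) :=
      HasFDerivAt.comp (e_[x₀] x) h3.hasFDerivAt (hasFDerivAt_prodMk_right t (e_[x₀] x))
    have hd3 := (hasMFDerivAt_chart_symm (x₀ := x₀) (hUT h2.2.1))
    have hd := (HasMFDerivAt.comp x hd3 (HasMFDerivAt.comp x hd2.hasMFDerivAt hd1)).mfderiv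
    set v' : E := mfderiv 𝓘(ℝ, E) 𝓘(ℝ, E) (e_[x₀]) x v with hv'
    have h5 : localForm α.form x₀ (e_[x₀] x) v' = 0 := by
      rw [localForm_apply]
      have h6 : chartDeriv E x₀ (e_[x₀] x) v' = v :=
        congrArg (fun L : E →L[ℝ] E => L v) (chartDeriv_comp_mfderiv hx')
      rw [h6]
      have h7 : ∀ x', x' = x → (α.form x' : E →L[ℝ] ℝ) v = 0 := by
        rintro x' rfl; exact hv
      exact h7 _ ((e_[x₀]).left_inv hx')
    have h8 := h1 v' h5
    rw [localForm_apply] at h8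
    refine Eq.trans ?_ h8
    exact congrArg (fun L : E →L[ℝ] E =>
      (α.form ((e_[x₀]).symm (ψ (t, e_[x₀] x))) : E →L[ℝ] ℝ) (L v)) hd

/-- Any t is a sum of n + 1 copies of t/(n + 1), which is small for some n. Together with the group
law, this carries properties of a flow from short times to all times. -/
theorem Real.mem_of_forall_add_mem {A : Set ℝ} (h0 : ∀ᶠ t in 𝓝 (0 : ℝ), t ∈ A)
    (hadd : ∀ s ∈ A, ∀ t ∈ A, s + t ∈ A) (t : ℝ) : t ∈ A := by
  have hlim : Tendsto (fun n : ℕ => t / ((n : ℝ) + 1)) atTop (𝓝 0) :=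
    (tendsto_const_div_atTop_nhds_zero_nat t).comp (tendsto_add_atTop_nat 1) |>.congr
      fun n => by simp
  obtain ⟨n, hn⟩ := (hlim.eventually h0).exists
  have key : ∀ k : ℕ, ((k : ℝ) + 1) * (t / ((n : ℝ) + 1)) ∈ A := by
    intro k
    induction k with
    | zero => simpa using hn
    | succ k ih =>
      have := hadd _ ih _ hn
      push_cast
      convert this using 1
      ring
  have := key n
  rwa [mul_div_cancel₀ _ (by positivity)] at this

/-- The flow of a vector field on a compact manifold, from its local flows. -/
theorem exists_contact_flow [T2Space V] [CompactSpace V] {Z : ∀ x : V, TangentSpace 𝓘(ℝ, E) x}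
    (hZ : ContMDiff 𝓘(ℝ, E) 𝓘(ℝ, E).tangent ∞
      (fun x => (⟨x, Z x⟩ : TangentBundle 𝓘(ℝ, E) V)))
    (hloc : ∀ x₀, ∃ Φ : ℝ × V → V, ContMDiffAt (𝓘(ℝ, ℝ).prod 𝓘(ℝ, E)) 𝓘(ℝ, E) ∞ Φ (0, x₀) ∧
      (∃ ε > 0, ∀ᶠ x in 𝓝 x₀, Φ (0, x) = x ∧
        IsMIntegralCurveOn (fun t => Φ (t, x)) Z (Ioo (-ε) ε)) ∧
      ∀ᶠ p in 𝓝 ((0 : ℝ), x₀), ∀ v, α.form p.2 v = 0 →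
        α.form (Φ p) (mfderiv 𝓘(ℝ, E) 𝓘(ℝ, E) (fun x => Φ (p.1, x)) p.2 v) = 0) :
    ∃ θ : ℝ → V → V, IsFlow Z θ ∧ ∀ t, Preserves α.contactStructure (θ t) := by
  have : IsManifold 𝓘(ℝ, E) 1 V := IsManifold.of_le (n := ∞) (by norm_cast)
  have : CompleteSpace E := FiniteDimensional.complete ℝ E
  have hZ1 := hZ.of_le (m := 1) (by norm_cast)
  -- Compactness provides one existence time for all starting points, which suffices to extend
  -- integral curves to the whole line.
  have huni : ∀ᶠ ε in 𝓝 (0 : ℝ), ∀ x ∈ (univ : Set V), 0 < ε →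
      ∃ γ : ℝ → V, γ 0 = x ∧ IsMIntegralCurveOn γ Z (Ioo (-ε) ε) := by
    refine isCompact_univ.eventually_forall_of_forall_eventually fun x₀ _ => ?_
    obtain ⟨Φ, -, ⟨ε, hε, hx⟩, -⟩ := hloc x₀
    filter_upwards [(continuous_fst.tendsto ((0 : ℝ), x₀)).eventually (gt_mem_nhds hε),
      (continuous_snd.tendsto ((0 : ℝ), x₀)).eventually hx] with p hp hpx _
    exact ⟨_, hpx.1, hpx.2.mono (Ioo_subset_Ioo (neg_le_neg hp.le) hp.le)⟩
  obtain ⟨ε, hε, hε0⟩ := ((huni.filter_mono nhdsWithin_le_nhds).and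
    (self_mem_nhdsWithin : ∀ᶠ t in 𝓝[>] (0 : ℝ), t ∈ Ioi 0)).exists
  choose γ hγ0 hγ using exists_isMIntegralCurve_of_isMIntegralCurveOn hZ1 hε0
    (fun x => hε x (mem_univ _) hε0)
  have hadd := flow_add hZ1 (θ := fun t x => γ x t) hγ0 hγ
  have hagree : ∀ x₀, ∀ Φ : ℝ × V → V, (∃ ε > 0, ∀ᶠ x in 𝓝 x₀, Φ (0, x) = x ∧
        IsMIntegralCurveOn (fun t => Φ (t, x)) Z (Ioo (-ε) ε)) →
        (fun p : ℝ × V => γ p.2 p.1) =ᶠ[𝓝 (0, x₀)] Φ := by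
    rintro x₀ Φ ⟨ε, hε, hx⟩
    filter_upwards [(continuous_fst.tendsto ((0 : ℝ), x₀)).eventually
      (Ioo_mem_nhds (neg_lt_zero.2 hε) hε),
      (continuous_snd.tendsto ((0 : ℝ), x₀)).eventually hx] with p hp hpx
    exact isMIntegralCurveOn_Ioo_eqOn_of_contMDiff_boundaryless (t₀ := 0)
      ⟨neg_lt_zero.2 hε, hε⟩ hZ1 ((hγ p.2).isMIntegralCurveOn _) hpx.2
      ((hγ0 _).trans hpx.1.symm) hp
  -- The order is kept finite because being C^n at a point then extends to a neighbourhood, as the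
  -- compactness argument requires; this fails at order ∞.
  have hsm : ∀ (n : ℕ) (t : ℝ) (x : V), ContMDiffAt (𝓘(ℝ, ℝ).prod 𝓘(ℝ, E)) 𝓘(ℝ, E) n
      (fun p : ℝ × V => γ p.2 p.1) (t, x) := by
    intro n t
    refine Real.mem_of_forall_add_mem (A := {t | ∀ x, ContMDiffAt (𝓘(ℝ, ℝ).prod 𝓘(ℝ, E)) 𝓘(ℝ, E) n
      (fun p : ℝ × V => γ p.2 p.1) (t, x)}) ?_ ?_ t
    · have h := (isCompact_univ (X := V)).eventually_forall_of_forall_eventually (x₀ := (0 : ℝ))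
        (P := fun t x => ContMDiffAt (𝓘(ℝ, ℝ).prod 𝓘(ℝ, E)) 𝓘(ℝ, E) n
          (fun p : ℝ × V => γ p.2 p.1) (t, x)) fun x₀ _ => by
        obtain ⟨Φ, hΦ, hx, -⟩ := hloc x₀
        have : IsManifold 𝓘(ℝ, E) n V := IsManifold.of_le (n := ∞) (by exact_mod_cast le_top)
        have h1 := (hΦ.congr_of_eventuallyEq (hagree x₀ Φ hx)).of_le (m := n)
          (by exact_mod_cast le_top)
        exact (contMDiffAt_iff_contMDiffAt_nhds (by simp)).1 h1
      filter_upwards [h] with t ht x using ht x (mem_univ _)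
    · intro s hs t ht x
      have h1 : (fun p : ℝ × V => γ p.2 p.1) = fun p => γ (γ p.2 (p.1 - s)) s := by
        funext p
        rw [← hadd, add_sub_cancel]
      rw [h1]
      have h2 : ContMDiffAt (𝓘(ℝ, ℝ).prod 𝓘(ℝ, E)) (𝓘(ℝ, ℝ).prod 𝓘(ℝ, E)) n
          (fun p : ℝ × V => (p.1 - s, p.2)) (s + t, x) :=
        (contMDiffAt_fst.sub contMDiffAt_const).prodMk contMDiffAt_snd
      have h3 : ContMDiffAt (𝓘(ℝ, ℝ).prod 𝓘(ℝ, E)) 𝓘(ℝ, E) n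
          (fun p : ℝ × V => γ p.2 (p.1 - s)) (s + t, x) := by
        refine ContMDiffAt.comp (s + t, x) (g := fun p : ℝ × V => γ p.2 p.1) ?_ h2
        simpa using ht x
      exact ContMDiffAt.comp (s + t, x) (g := fun p : ℝ × V => γ p.2 p.1)
        (hs (γ x (s + t - s))) (contMDiffAt_const.prodMk h3)
  have hsmooth : ContMDiff (𝓘(ℝ, ℝ).prod 𝓘(ℝ, E)) 𝓘(ℝ, E) ∞ (fun p : ℝ × V => γ p.2 p.1) :=
    fun p => contMDiffAt_infty.2 fun n => hsm n p.1 p.2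
  have hdiff : ∀ t, MDifferentiable 𝓘(ℝ, E) 𝓘(ℝ, E) (fun x => γ x t) := fun t =>
    (hsmooth.comp (contMDiff_const.prodMk contMDiff_id) :
      ContMDiff 𝓘(ℝ, E) 𝓘(ℝ, E) ∞ (fun x => γ x t)).mdifferentiable (by simp)
  have hpres : ∀ (t : ℝ) (x : V) (v : TangentSpace 𝓘(ℝ, E) x), α.form x v = 0 →
      α.form (γ x t) (mfderiv 𝓘(ℝ, E) 𝓘(ℝ, E) (fun x => γ x t) x v) = 0 := by
    intro t
    refine Real.mem_of_forall_add_mem (A := {t | ∀ (x : V) (v : TangentSpace 𝓘(ℝ, E) x),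
      α.form x v = 0 →
      α.form (γ x t) (mfderiv 𝓘(ℝ, E) 𝓘(ℝ, E) (fun x => γ x t) x v) = 0}) ?_ ?_ t
    · have h := (isCompact_univ (X := V)).eventually_forall_of_forall_eventually (x₀ := (0 : ℝ))
        (P := fun t x => ∀ (v : TangentSpace 𝓘(ℝ, E) x), α.form x v = 0 →
          α.form (γ x t) (mfderiv 𝓘(ℝ, E) 𝓘(ℝ, E) (fun x => γ x t) x v) = 0) fun x₀ _ => by
        obtain ⟨Φ, -, hx, hv⟩ := hloc x₀
        filter_upwards [(hagree x₀ Φ hx).eventually_nhds, hv] with p hp hv v hv0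
        have h1 : (fun x => γ x p.1) =ᶠ[𝓝 p.2] fun x => Φ (p.1, x) :=
          ((Continuous.prodMk_right p.1).tendsto p.2).eventually hp
        have h2 := hv v hv0
        rw [h1.mfderiv_eq]
        have h3 : ∀ x', x' = Φ p → (α.form x' : E →L[ℝ] ℝ)
            (mfderiv 𝓘(ℝ, E) 𝓘(ℝ, E) (fun x => Φ (p.1, x)) p.2 v : E) = 0 := by
          rintro x' rfl; exact h2
        exact h3 _ hp.self_of_nhds
      filter_upwards [h] with t ht x using ht x (mem_univ _)
    · intro s hs t ht x v hv
      have h1 : (fun x => γ x (s + t)) = (fun x => γ x s) ∘ fun x => γ x t := funext (hadd s t)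
      have h2 := hs _ _ (ht x v hv)
      have h3 : mfderiv 𝓘(ℝ, E) 𝓘(ℝ, E) (fun x => γ x (s + t)) x =
          (mfderiv 𝓘(ℝ, E) 𝓘(ℝ, E) (fun x => γ x s) (γ x t)).comp
            (mfderiv 𝓘(ℝ, E) 𝓘(ℝ, E) (fun x => γ x t) x) := by
        rw [h1]
        exact mfderiv_comp x (hdiff s _) (hdiff t x)
      rw [h3]
      have h4 : ∀ x', x' = γ (γ x t) s → (α.form x' : E →L[ℝ] ℝ)
          (mfderiv 𝓘(ℝ, E) 𝓘(ℝ, E) (fun x => γ x s) (γ x t)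
            (mfderiv 𝓘(ℝ, E) 𝓘(ℝ, E) (fun x => γ x t) x v) : E) = 0 := by
        rintro x' rfl; exact h2
      exact h4 _ (hadd s t x)
  refine ⟨fun t x => γ x t, ⟨hsmooth, hγ0, hγ⟩, fun t x v => ⟨fun hv => ?_, fun hv => hpres t x v hv⟩⟩
  -- The reverse implication comes from applying the forward one to the inverse map, the flow at
  -- time −t.
  have h1 := hpres (-t) _ _ hv
  have h2 : (fun x => γ x (-t)) ∘ (fun x => γ x t) = id :=
    funext fun x => (hadd (-t) t x).symm.trans (by simp [hγ0])
  have h3 := mfderiv_comp x (hdiff (-t) (γ x t)) (hdiff t x)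
  rw [h2, mfderiv_id] at h3
  have h4 : (mfderiv 𝓘(ℝ, E) 𝓘(ℝ, E) (fun x => γ x (-t)) (γ x t)
      (mfderiv 𝓘(ℝ, E) 𝓘(ℝ, E) (fun x => γ x t) x v) : E) = v :=
    (congrArg (fun L : E →L[ℝ] E => L v) h3).symm
  change (α.form x : E →L[ℝ] ℝ) v = 0
  have h5 : ∀ (x' : V) (w : E), x' = x → w = v → (α.form x' : E →L[ℝ] ℝ) w = 0 →
      (α.form x : E →L[ℝ] ℝ) v = 0 := by
    rintro x' w rfl rfl h; exact h
  exact h5 _ _ (congrFun h2 x) h4 h1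

end GlobalFlow

/-! ### Isotopies generated by flows -/

section FlowIsotopy

variable {E : Type*} [NormedAddCommGroup E] [NormedSpace ℝ E]
  {V : Type*} [TopologicalSpace V] [ChartedSpace E V] [IsManifold 𝓘(ℝ, E) ∞ V]
  {α : ContactForm E V} {X : ∀ x : V, TangentSpace 𝓘(ℝ, E) x} {θ : ℝ → V → V}

/-- The isotopy `t ↦ θ_{ct}` defined by a flow `θ` of contactomorphisms. -/
def IsFlow.isotopy (hθ : IsFlow X θ) (hadd : ∀ s t x, θ (s + t) x = θ s (θ t x))
    (hpres : ∀ t, Preserves α.contactStructure (θ t)) (c : ℝ) :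
    ContactIsotopy α.contactStructure where
  at_ t := ⟨θ (t * c), θ (-(t * c)), fun x => by rw [← hadd, neg_add_cancel, hθ.zero],
    fun x => by rw [← hadd, add_neg_cancel, hθ.zero]⟩
  smooth := by
    have h1 : ContMDiff (𝓘(ℝ, ℝ).prod 𝓘(ℝ, E)) (𝓘(ℝ, ℝ).prod 𝓘(ℝ, E)) ∞
        (fun p : ℝ × V => (p.1 * c, p.2)) :=
      (((contDiff_id.mul contDiff_const : ContDiff ℝ ∞ fun t : ℝ => t * c).contMDiff).comp
        contMDiff_fst).prodMk contMDiff_snd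
    have h2 : ContMDiff (𝓘(ℝ, ℝ).prod 𝓘(ℝ, E)) (𝓘(ℝ, ℝ).prod 𝓘(ℝ, E)) ∞
        (fun p : ℝ × V => (-(p.1 * c), p.2)) :=
      (((contDiff_id.mul contDiff_const : ContDiff ℝ ∞ fun t : ℝ => t * c).neg.contMDiff).comp
        contMDiff_fst).prodMk contMDiff_snd
    exact ⟨(hθ.smooth.comp h1).contMDiffOn, (hθ.smooth.comp h2).contMDiffOn⟩
  zero := Equiv.ext fun x => by simp [hθ.zero]
  contact t _ := hpres (t * c)

theorem IsFlow.isotopy_apply (hθ : IsFlow X θ) (hadd : ∀ s t x, θ (s + t) x = θ s (θ t x))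
    (hpres : ∀ t, Preserves α.contactStructure (θ t)) (c t : ℝ) (x : V) :
    (hθ.isotopy hadd hpres c).at_ t x = θ (t * c) x := rfl

theorem IsFlow.isGeneratedBy_isotopy (hθ : IsFlow X θ)
    (hadd : ∀ s t x, θ (s + t) x = θ s (θ t x))
    (hpres : ∀ t, Preserves α.contactStructure (θ t)) (c : ℝ) :
    IsGeneratedBy α (hθ.isotopy hadd hpres c) (fun _ x => c * α.form x (X x)) := by
  intro t ht x
  have h := (((hθ.integral x).comp_mul c) t).hasMFDerivWithinAt (s := Icc (0 : ℝ) 1)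
    |>.mfderivWithin (uniqueMDiffWithinAt_unitInterval ht)
  have h1 : ((hθ.isotopy hadd hpres c).velocity t x : E) = c • (X (θ (t * c) x) : E) :=
    (congrArg (fun w : ℝ →L[ℝ] E => w 1) h).trans (one_smul ℝ (c • (X (θ (t * c) x) : E)))
  have h2 := congrArg (fun w : E => (α.form (θ (t * c) x) : E →L[ℝ] ℝ) w) h1
  exact h2.trans (map_smul _ _ _)

theorem IsFlow.isotopy_pow (hθ : IsFlow X θ) (hadd : ∀ s t x, θ (s + t) x = θ s (θ t x))
    (hpres : ∀ t, Preserves α.contactStructure (θ t)) (c : ℝ) (n : ℕ) :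
    hθ.isotopy hadd hpres c ^ n = hθ.isotopy hadd hpres (n * c) := by
  induction n with
  | zero =>
    refine ContactIsotopy.ext (funext fun t => Equiv.ext fun x => ?_)
    rw [pow_zero, ContactIsotopy.one_at, hθ.isotopy_apply]
    simp [hθ.zero]
  | succ n ih =>
    refine ContactIsotopy.ext (funext fun t => Equiv.ext fun x => ?_)
    rw [pow_succ, ih, ContactIsotopy.mul_at, Equiv.Perm.mul_apply, hθ.isotopy_apply,
      hθ.isotopy_apply, hθ.isotopy_apply, ← hadd]
    congr 1
    push_cast
    ring

/-- A contact vector field comes with some flow preserving ξ; uniqueness of integral curves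
identifies the given flow with it. -/
theorem IsFlow.preserves [T2Space V] {X : ∀ x : V, TangentSpace 𝓘(ℝ, E) x}
    {ξ : ∀ x : V, Submodule ℝ (TangentSpace 𝓘(ℝ, E) x)}
    (hX : IsContactVectorField ξ X) {θ : ℝ → V → V} (hθ : IsFlow X θ) (t : ℝ) :
    Preserves ξ (θ t) := by
  have : IsManifold 𝓘(ℝ, E) 1 V := IsManifold.of_le (n := ∞) (by norm_cast)
  obtain ⟨θ', hθ', h⟩ := hX.preserves
  have : θ = θ' := funext fun t => funext fun x => congrFun
    (isMIntegralCurve_Ioo_eq_of_contMDiff_boundaryless (t₀ := 0)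
      (hX.smooth.of_le (m := 1) (by norm_cast)) (hθ.integral x) (hθ'.integral x)
      ((hθ.zero x).trans (hθ'.zero x).symm)) t
  exact this ▸ h t

end FlowIsotopy

section Existence

variable {E : Type*} [NormedAddCommGroup E] [NormedSpace ℝ E] [FiniteDimensional ℝ E]
  {V : Type*} [TopologicalSpace V] [ChartedSpace E V] [IsManifold 𝓘(ℝ, E) ∞ V]
  [T2Space V] [CompactSpace V] (α : ContactForm E V)

/-- Every smooth function on a closed contact manifold generates a contact isotopy. -/
theorem exists_isGeneratedBy {f : V → ℝ} (hf : ContMDiff 𝓘(ℝ, E) 𝓘(ℝ, ℝ) ∞ f) :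
    ∃ φ : ContactIsotopy α.contactStructure, IsGeneratedBy α φ (fun _ => f) := by
  obtain ⟨Z, hZf, hZ⟩ := exists_contactField α hf
  have hZs : ContMDiff 𝓘(ℝ, E) 𝓘(ℝ, E).tangent ∞
      (fun x => (⟨x, Z x⟩ : TangentBundle 𝓘(ℝ, E) V)) := fun x₀ => by
    obtain ⟨U, S, G, hU, hx₀, hUT, hS, -, -, h⟩ := hZ x₀
    exact contMDiffAt_of_chart hU hx₀ hUT hS h
  obtain ⟨θ, hθ, hpres⟩ := exists_contact_flow α hZs fun x₀ => by
    obtain ⟨U, S, G, hU, hx₀, hUT, hS, hG, hsol, h⟩ := hZ x₀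
    exact exists_local_contact_flow α hU hx₀ hUT hS hG hsol h
  have hadd := flow_add (hZs.of_le (m := 1) (by norm_cast)) hθ.zero hθ.integral
  refine ⟨hθ.isotopy hadd hpres 1, ?_⟩
  have h := hθ.isGeneratedBy_isotopy hadd hpres 1
  simpa only [one_mul, hZf] using h

end Existence

/-! ### Subheavy sets invariant under a positive flow -/

section Main

variable {E : Type*} [NormedAddCommGroup E] [NormedSpace ℝ E]
  {V : Type*} [TopologicalSpace V] [ChartedSpace E V] [IsManifold 𝓘(ℝ, E) ∞ V]
  {α : ContactForm E V}

/-- A pointwise form of the comparison of Hamiltonians: it lets an inequality valid only near Y be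
used. -/
theorem ContactIsotopy.hamiltonian_inv_mul_nonneg_iff (φ ψ : ContactIsotopy α.contactStructure)
    {t : ℝ} (ht : t ∈ Icc (0 : ℝ) 1) (z : V) :
    0 ≤ (φ⁻¹ * ψ).hamiltonian α t z ↔
      φ.hamiltonian α t (φ.at_ t z) ≤ ψ.hamiltonian α t (φ.at_ t z) := by
  obtain ⟨x, rfl⟩ := ((φ⁻¹ * ψ).at_ t).surjective z
  have h1 := ContactIsotopy.alphaVelocity_mul φ (φ⁻¹ * ψ) ht x
  rw [mul_inv_cancel_left] at h1
  have h2 : φ.at_ t ((φ⁻¹ * ψ).at_ t x) = ψ.at_ t x := (φ.at_ t).apply_symm_apply _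
  rw [ContactIsotopy.hamiltonian_apply, φ.hamiltonian_apply, h2, ψ.hamiltonian_apply, h1,
    le_add_iff_nonneg_right, φ.alphaDeriv_nonneg_iff ht]
  rfl

/-- Conjugation transports the Hamiltonian by ψ₁ up to a positive conformal factor, so the region of
nonnegativity moves with ψ₁. -/
theorem ContactIsotopy.hamiltonian_conjEnd_nonneg (ψ φ : ContactIsotopy α.contactStructure)
    {t : ℝ} (ht : t ∈ Icc (0 : ℝ) 1) {z : V} (h : 0 ≤ φ.hamiltonian α t ((ψ.at_ 1)⁻¹ z)) :
    0 ≤ (ψ.conjEnd φ).hamiltonian α t z := by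
  obtain ⟨x, rfl⟩ := ((ψ.conjEnd φ).at_ t).surjective z
  have h1 : (ψ.at_ 1)⁻¹ ((ψ.conjEnd φ).at_ t x) = φ.at_ t ((ψ.at_ 1)⁻¹ x) :=
    (ψ.at_ 1).symm_apply_apply _
  rw [h1, φ.hamiltonian_apply] at h
  rw [ContactIsotopy.hamiltonian_apply, alphaVelocity_conjEnd ψ φ ht]
  exact (ψ.alphaDeriv_nonneg_iff (by simp) _ _).2 h

/-- A monotone quasi-morphism is positive on elements whose powers dominate the whole group. -/
theorem IsMonotoneQuasimorphism.pos_of_dominating {μ : UnivCont α.contactStructure → ℝ}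
    (hμ : IsMonotoneQuasimorphism α μ) {T : UnivCont α.contactStructure}
    (hT : ∀ a, ∃ n : ℕ, Precedes α a (T ^ n)) : 0 < μ T := by
  by_contra! hneg
  -- If μ(T) ≤ 0, domination forces μ ≤ 0 everywhere; applied to inverses this gives μ = 0, which is
  -- excluded.
  have hle : ∀ a, μ a ≤ 0 := fun a => by
    obtain ⟨n, hn⟩ := hT a
    have h1 := hμ.monotone _ _ hn
    have h2 := hμ.homogeneous T n
    rw [zpow_natCast] at h2
    rw [h2] at h1
    exact h1.trans (mul_nonpos_of_nonneg_of_nonpos (by positivity) hneg)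
  obtain ⟨a, ha⟩ := hμ.nonzero
  have h1 := hμ.homogeneous a (-1)
  rw [zpow_neg_one] at h1
  push_cast at h1
  exact ha (le_antisymm (hle a) (by linarith [hle a⁻¹]))

/-- Moving all copies of T to the left in (Tr)ᵏ leaves a product of k conjugates T⁻ʲ r Tʲ, each
above e; bi-invariance multiplies the inequalities. -/
theorem Precedes.pow_le_of_conj {a e T r : UnivCont α.contactStructure} (ha : a = T * r) {N : ℕ}
    (he : ∀ j < N, Precedes α e ((T ^ j)⁻¹ * r * T ^ j)) :
    ∀ k ≤ N, Precedes α (e ^ k) ((T ^ k)⁻¹ * a ^ k) := by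
  intro k
  induction k with
  | zero => intro _; simpa using Precedes.refl 1
  | succ k ih =>
    intro hk
    have h := (he k hk).mul (ih (by omega))
    rw [← pow_succ'] at h
    have h2 : (T ^ k)⁻¹ * r * T ^ k * ((T ^ k)⁻¹ * a ^ k) = (T ^ (k + 1))⁻¹ * a ^ (k + 1) := by
      rw [pow_succ' a, pow_succ' T, ha]
      simp only [mul_inv_rev, mul_assoc, inv_mul_cancel_left, mul_inv_cancel_left]
    rwa [h2] at h

variable [FiniteDimensional ℝ E] [T2Space V] [CompactSpace V]

/-- Take f = −|C|u, with C a bound for the Hamiltonian and u a smooth Urysohn function, 0 on Y and 1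
off W. On W, f ≤ 0 lies below the Hamiltonian; off W, f is at most its lower bound. -/
theorem ContactIsotopy.exists_smooth_le_hamiltonian {Y W : Set V} (hY : IsClosed Y)
    (hW : IsOpen W) (hYW : Y ⊆ W) {φ : ContactIsotopy α.contactStructure}
    (hφ : ∀ t ∈ Icc (0 : ℝ) 1, ∀ z ∈ W, 0 ≤ φ.hamiltonian α t z) :
    ∃ f : V → ℝ, ContMDiff 𝓘(ℝ, E) 𝓘(ℝ, ℝ) ∞ f ∧ (∀ y ∈ Y, f y = 0) ∧ (∀ z, f z ≤ 0) ∧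
      ∀ t ∈ Icc (0 : ℝ) 1, ∀ z, f z ≤ φ.hamiltonian α t z := by
  obtain ⟨C, hC⟩ := φ.exists_bound_alphaVelocity
  obtain ⟨u, hu0, hu1, hu⟩ := exists_contMDiffMap_zero_one_of_isClosed 𝓘(ℝ, E) (n := ⊤) hY
    hW.isClosed_compl (disjoint_compl_right_iff_subset.2 hYW)
  refine ⟨fun z => -|C| * u z, contMDiff_const.mul u.contMDiff, fun y hy => ?_, fun z => ?_,
    fun t ht z => ?_⟩
  · simp [hu0 hy]
  · nlinarith [abs_nonneg C, (hu z).1]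
  · by_cases hz : z ∈ W
    · nlinarith [abs_nonneg C, (hu z).1, hφ t ht z hz]
    · have h1 : u z = 1 := hu1 hz
      have h2 := (abs_le.1 (hC t ht ((φ.at_ t)⁻¹ z))).1
      have h3 : φ.hamiltonian α t z = φ.alphaVelocity α t ((φ.at_ t)⁻¹ z) := rfl
      change -|C| * u z ≤ _
      rw [h1, h3]
      linarith [le_abs_self C]

/-- Finitely many isotopies whose contact Hamiltonians are nonnegative near a subheavy set are
bounded below by a common element on which the quasi-morphism vanishes. -/
theorem IsSubheavy.exists_common_lower_bound {μ : UnivCont α.contactStructure → ℝ} {Y : Set V}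
    (hY : IsSubheavy α μ Y) (φ : ℕ → ContactIsotopy α.contactStructure)
    (hφ : ∀ j, ∃ W, IsOpen W ∧ Y ⊆ W ∧
      ∀ t ∈ Icc (0 : ℝ) 1, ∀ z ∈ W, 0 ≤ (φ j).hamiltonian α t z) (N : ℕ) :
    ∃ e, μ e = 0 ∧ ∀ j < N, Precedes α e (φ j).toUniv := by
  choose W hW hYW hpos using hφ
  choose f hf hfY hf0 hfle using fun j => ContactIsotopy.exists_smooth_le_hamiltonian hY.isClosed
    (hW j) (hYW j) (hpos j)
  -- A sum of nonpositive functions lies below each summand and, unlike a minimum, is smooth; it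
  -- still vanishes on Y.
  have hsm : ContMDiff 𝓘(ℝ, E) 𝓘(ℝ, ℝ) ∞ (fun z => ∑ j ∈ Finset.range N, f j z) :=
    contMDiff_finsetSum fun j _ => hf j
  obtain ⟨ε, hε⟩ := exists_isGeneratedBy α hsm
  refine ⟨ε.toUniv, hY.eq_zero _ hsm
    (fun y hy => Finset.sum_eq_zero fun j _ => hfY j y hy) ε hε, fun j hj => ?_⟩
  refine precedes_of_hamiltonian_le fun t ht z => ?_
  rw [hε.hamiltonian_eq ht]
  refine le_trans ?_ (hfle j t ht z)
  rw [← Finset.add_sum_erase _ _ (Finset.mem_range.2 hj)]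
  linarith [Finset.sum_nonpos fun i (_ : i ∈ (Finset.range N).erase j) => hf0 i z]

end Main

end ContactQM

end

open ContactQM in
theorem propositionp
    {E : Type*} [NormedAddCommGroup E] [NormedSpace ℝ E] [FiniteDimensional ℝ E]
    {V : Type*} [TopologicalSpace V] [ChartedSpace E V] [IsManifold 𝓘(ℝ, E) ∞ V]
    [T2Space V] [CompactSpace V] [ConnectedSpace V]
    (α : ContactQM.ContactForm E V)
    (μ : ContactQM.UnivCont α.contactStructure → ℝ)
    (hμ : ContactQM.IsMonotoneQuasimorphism α μ)
    (Y : Set V) (hY : ContactQM.IsSubheavy α μ Y)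
    (X : ∀ x : V, TangentSpace 𝓘(ℝ, E) x)
    (hX : ContactQM.IsContactVectorField α.contactStructure X)
    (hpos : ∀ x, 0 < α.form x (X x))
    (θ : ℝ → V → V) (hθ : ContactQM.IsFlow X θ)
    (hinv : ∀ t, θ t '' Y = Y) :
    ContactQM.IsSuperheavy α μ Y := by
  refine ⟨hY.isClosed, fun h hh hhY φ hφ => ?_⟩
  have hpres := hθ.preserves hX
  have hadd := flow_add (hX.smooth.of_le (m := 1) (by norm_cast)) hθ.zero hθ.integral
  have hXc : Continuous fun x => α.form x (X x) := α.continuous_apply.comp hX.smooth.continuous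
  obtain ⟨m, hm, hmX⟩ := isCompact_univ.exists_forall_le' hXc.continuousOn
    (fun x _ => hpos x)
  obtain ⟨c', hc', hc'Y⟩ := hY.isClosed.isCompact.exists_forall_le'
    (hh.continuous.div hXc fun x => (hpos x).ne').continuousOn
    (fun y hy => div_pos (hhY y hy) (hpos y))
  -- Halving makes the inequality c·α(X) < h strict on Y, so that it is an open condition for the
  -- tube lemma.
  set c := c' / 2 with hc
  have hc0 : 0 < c := by positivity
  have hcY : ∀ y ∈ Y, c * α.form y (X y) < h y := fun y hy => by
    have h1 := (le_div_iff₀ (hpos y)).1 (hc'Y y hy)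
    nlinarith [hpos y]
  set τ := hθ.isotopy hadd hpres c with hτ
  have hτg : IsGeneratedBy α τ _ := hθ.isGeneratedBy_isotopy hadd hpres c
  have hTpos : 0 < μ τ.toUniv := by
    refine hμ.pos_of_dominating fun a => ?_
    obtain ⟨ψ, rfl⟩ := exists_toUniv_eq a
    obtain ⟨C, hC⟩ := ψ.exists_bound_alphaVelocity
    -- The n-th power of τ has Hamiltonian n·c·α(X) ≥ n·c·m ≥ C, which dominates that of ψ.
    obtain ⟨n, hn⟩ := exists_nat_ge (C / (c * m))
    refine ⟨n, ?_⟩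
    rw [← ContactIsotopy.toUniv_pow, hτ, hθ.isotopy_pow]
    refine precedes_of_hamiltonian_le fun t ht z => ?_
    rw [(hθ.isGeneratedBy_isotopy hadd hpres _).hamiltonian_eq ht]
    have h1 : ψ.hamiltonian α t z ≤ C := (abs_le.1 (hC t ht _)).2
    rw [div_le_iff₀ (by positivity)] at hn
    have h2 := mul_le_mul_of_nonneg_left (hmX z (mem_univ z))
      (by positivity : (0 : ℝ) ≤ n * c)
    linarith
  have hstep : ∀ (j : ℕ) (y : V), y ∈ Y → (τ ^ j).at_ 1 y ∈ Y := fun j y hy => by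
    rw [hτ, hθ.isotopy_pow, hθ.isotopy_apply]
    exact (hinv _).subset (mem_image_of_mem _ hy)
  set ρ := τ⁻¹ * φ with hρ
  -- Invariance of Y puts [0,1] × Y inside the open set where the strict inequality holds at
  -- θ_{tc}(x); the tube gives a neighbourhood W of Y valid for all t at once.
  obtain ⟨I, W, -, hW, hIW, hYW, hsub⟩ := generalized_tube_lemma (s := Icc (0 : ℝ) 1) isCompact_Icc
    hY.isClosed.isCompact
    (n := {p : ℝ × V | c * α.form (θ (p.1 * c) p.2) (X (θ (p.1 * c) p.2)) < h (θ (p.1 * c) p.2)})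
    (by
      have hcont : Continuous fun p : ℝ × V => θ (p.1 * c) p.2 :=
        hθ.smooth.continuous.comp (by fun_prop : Continuous fun p : ℝ × V => (p.1 * c, p.2))
      exact isOpen_lt (continuous_const.mul (hXc.comp hcont)) (hh.continuous.comp hcont))
    (fun p hp => hcY _ ((hinv _).subset (mem_image_of_mem _ hp.2)))
  have hρW : ∀ t ∈ Icc (0 : ℝ) 1, ∀ z ∈ W, 0 ≤ ρ.hamiltonian α t z := fun t ht z hz => by
    rw [hρ, ContactIsotopy.hamiltonian_inv_mul_nonneg_iff _ _ ht, hφ.hamiltonian_eq ht,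
      hτg.hamiltonian_eq ht]
    exact (hsub (mk_mem_prod (hIW ht) hz)).le
  have hconj : ∀ j : ℕ, ∃ W, IsOpen W ∧ Y ⊆ W ∧ ∀ t ∈ Icc (0 : ℝ) 1, ∀ z ∈ W,
      0 ≤ ((τ ^ j)⁻¹.conjEnd ρ).hamiltonian α t z := fun j => by
    -- The neighbourhood may shrink with j, which is harmless because only finitely many j are used
    -- for each N.
    refine ⟨(τ ^ j).at_ 1 ⁻¹' W,
      hW.preimage ((τ ^ j).smooth.contMDiff (by simp)).continuous,
      fun y hy => hYW (hstep j y hy), fun t ht z hz => ?_⟩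
    refine ContactIsotopy.hamiltonian_conjEnd_nonneg _ _ ht (hρW t ht _ ?_)
    rwa [ContactIsotopy.inv_at, inv_inv]
  obtain ⟨D, -, hD⟩ := hμ.bounded
  have hmain : ∀ N : ℕ, N * μ τ.toUniv - D ≤ N * μ φ.toUniv := fun N => by
    obtain ⟨e, he0, he⟩ := hY.exists_common_lower_bound _ hconj N
    have hφρ : φ.toUniv = τ.toUniv * ρ.toUniv := by
      rw [← ContactIsotopy.toUniv_mul, hρ, mul_inv_cancel_left]
    have h1 := Precedes.pow_le_of_conj hφρ (N := N) (fun j hj => by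
      have h := he j hj
      rwa [ContactIsotopy.toUniv_conjEnd, ContactIsotopy.toUniv_inv, inv_inv,
        ContactIsotopy.toUniv_pow] at h) N le_rfl
    have h2 := hμ.monotone _ _ h1
    have h3 := hμ.homogeneous e N
    have h4 := hμ.homogeneous τ.toUniv N
    have h5 := hμ.homogeneous φ.toUniv N
    rw [zpow_natCast] at h3 h4 h5
    -- The only use of the quasi-morphism defect: once for each N, so its cost per iterate is D/N.
    have h6 := (abs_le.1 (hD (τ.toUniv ^ N) ((τ.toUniv ^ N)⁻¹ * φ.toUniv ^ N))).1
    rw [mul_inv_cancel_left, h4] at h6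
    rw [h3, he0, mul_zero] at h2
    push_cast at h5 h6
    linarith
  have hle : μ τ.toUniv ≤ μ φ.toUniv := by
    by_contra! hlt
    obtain ⟨N, hN⟩ := exists_nat_gt (D / (μ τ.toUniv - μ φ.toUniv))
    rw [div_lt_iff₀ (by linarith)] at hN
    linarith [hmain N]
  exact hTpos.trans_le hle
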